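/- Let $N\ge 2$ and $d,p\ge 1$ be integers, $A\in\mathbb{R}^{d\times d}$, $B\in\mathbb{R}^{d\times p}$, and let $Q\in\mathbb{R}^{d\times d}$, $R\in\mathbb{R}^{p\times p}$ be symmetric positive definite. Let $(G_k)_{k\in\kappa}$ be a finite nonempty family of connected undirected weighted graphs on $\{1,\dots,N\}$, given by symmetric weights $w_{k,ij}=w_{k,ji}\ge 0$ with $w_{k,ii}=0$, where $\{i,j\}$ is an edge of $G_k$ exactly when $w_{k,ij}>0$. Let $L_k$ be the Laplacian matrix of $G_k$, with eigenvalues $0=\lambda_{k,1}<\lambda_{k,2}\le\dots\le\lambda_{k,N}$, and put $\lambda_{\min}=\min_k\lambda_{k,2}$ and $\lambda_{\max}=\max_k\lambda_{k,N}$. Let $\sigma:[0,\infty)\to\kappa$ be a switching signal that is constant between consecutive switching times $0=t_0<t_1<\cdots$, where $t_k-t_{k-1}\ge T_{\rm d}$ for all $k\ge 1$ and some constant $T_{\rm d}>0$. Consider the linear network $$\dot x_i(t)=Ax_i(t)+Bu_i(t),\qquad u_i(t)=K\sum_{j=1}^N w_{\sigma(t),ij}\,(x_j(t)-x_i(t)),\qquad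 i=1,\dots,N,$$ with gain matrix $K\in\mathbb{R}^{p\times d}$ (trajectories are continuous on $[0,\infty)$ and satisfy the equations away from the switching times), and the cost $$J_C=\int_0^\infty\Big(\sum_{i=1}^N u_i^TRu_i+\sum_{i=1}^N\sum_{j=1}^N w_{\sigma(t),ij}(x_j-x_i)^TQ(x_j-x_i)\Big)dt .$$ The network achieves guaranteed-cost consensus with gain $K$ if for every initial state $x(0)=x_0$ there are a constant $\beta>0$ and a function $c:[0,\infty)\to\mathbb{R}^d$ such that $x_i(t)-c(t)\to 0$ as $t\to\infty$ for all $i$, and $J_C\le\beta$. It is guaranteed-cost consensualizable if this holds for some $K$. Suppose that $(A,B)$ is stabilizable (there is $F$ such that all eigenvalues of $A+BF$ have negative real part) and that the largest eigenvalue $\lambda_{R,\max}$ of $R$ satisfies $\lambda_{R,\max}<2\lambda_{\min}/\lambda_{\max}^2$. Then the network is guaranteed-cost consensualizable. More precisely, the Riccati equation $$A^TP+PA+P\big(\lambda_{\max}^2BRB^T-2\lambda_{\min}BB^T\big)P+3\lambda_{\max}Q=0$$ has a unique symmetric positive definite solution $P$; with $K=B^TP$ the network achieves guaranteed-cost consensus;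 and every trajectory of the network with this gain satisfies $$J_C\le\beta:=\frac1N\,x(0)^T\big((N I_N-\mathbf 1_N\mathbf 1_N^T)\otimes P\big)x(0),$$ where $x(0)$ is the stacked vector of $x_1(0),\dots,x_N(0)$, and $\beta>0$ unless all the $x_i(0)$ are equal. -/

import Mathlib

open scoped Matrix Kronecker Topology

noncomputable section

/-- An undirected weighted graph on the nodes `0, …, N - 1`: a symmetric nonnegative weight matrix
with zero diagonal. The pair `(j, i)` is an edge exactly when `weight i j > 0`. -/
structure WeightedGraph (N : ℕ) where
  weight : Matrix (Fin N) (Fin N) ℝ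
  weight_symm : ∀ i j, weight j i = weight i j
  weight_self : ∀ i, weight i i = 0
  weight_nonneg : ∀ i j, 0 ≤ weight i j

namespace WeightedGraph

variable {N : ℕ} (G : WeightedGraph N)

/-- The underlying undirected graph. -/
def graph : SimpleGraph (Fin N) where
  Adj i j := 0 < G.weight i j
  symm := ⟨fun i j h => by rw [G.weight_symm i j]; exact h⟩
  loopless := ⟨fun i h => by rw [G.weight_self i] at h; exact lt_irrefl _ h⟩

/-- The Laplacian matrix `L = D - W`. -/
def laplacian : Matrix (Fin N) (Fin N) ℝ :=
  Matrix.diagonal (fun i => ∑ j, G.weight i j) - G.weight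

theorem laplacian_isHermitian : G.laplacian.IsHermitian := by
  ext i j
  by_cases h : i = j
  · subst h; simp [laplacian]
  · simp [laplacian, Matrix.diagonal_apply_ne _ h, Matrix.diagonal_apply_ne _ (Ne.symm h),
      G.weight_symm i j]

end WeightedGraph

/-- The largest eigenvalue of a symmetric real matrix (of size at least one). -/
def largestEigenvalue {n : ℕ} {M : Matrix (Fin n) (Fin n) ℝ} (hM : M.IsHermitian) : ℝ :=
  ⨆ i, hM.eigenvalues i

/-- The second smallest eigenvalue, counted with multiplicity, of a symmetric real matrix of size
at least two (`eigenvalues₀` lists the eigenvalues in decreasing order, starting from index `0`). -/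
def secondSmallestEigenvalue {n : ℕ} (hn : 2 ≤ n) {M : Matrix (Fin n) (Fin n) ℝ}
    (hM : M.IsHermitian) : ℝ :=
  hM.eigenvalues₀ ⟨n - 2, by rw [Fintype.card_fin]; omega⟩

/-- `λ_min`: the minimum, over a finite nonempty family of graphs, of the second smallest Laplacian
eigenvalue. -/
def lambdaMin {N : ℕ} (hN : 2 ≤ N) {ι : Type*} (G : ι → WeightedGraph N) : ℝ :=
  ⨅ k, secondSmallestEigenvalue hN (G k).laplacian_isHermitian

/-- `λ_max`: the maximum, over a finite nonempty family of graphs, of the largest Laplacian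
eigenvalue. -/
def lambdaMax {N : ℕ} {ι : Type*} (G : ι → WeightedGraph N) : ℝ :=
  ⨆ k, largestEigenvalue (G k).laplacian_isHermitian

/-- A switching signal on `[0, ∞)` with values in `ι`: it is constant strictly between consecutive
switching times, which are separated by at least a dwell time `T_d > 0`. A signal with finitely many
switches is included, since the value need not change at a switching time. Values at negative times
play no role. -/
structure SwitchingSignal (ι : Type*) where
  signal : ℝ → ι
  dwell : ℝ
  dwell_pos : 0 < dwell
  times : ℕ → ℝ
  times_zero : times 0 = 0
  dwell_le : ∀ k, dwell ≤ times (k + 1) - times k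
  const : ∀ k, ∀ s ∈ Set.Ioo (times k) (times (k + 1)), ∀ t ∈ Set.Ioo (times k) (times (k + 1)),
    signal s = signal t

/-- A real square matrix is Hurwitz if all its complex eigenvalues have negative real part. -/
def IsHurwitz {d : ℕ} (M : Matrix (Fin d) (Fin d) ℝ) : Prop :=
  ∀ z ∈ spectrum ℂ (M.map (algebraMap ℝ ℂ)), z.re < 0

/-- `(A, B)` is stabilizable if some state feedback makes it Hurwitz. -/
def IsStabilizable {d p : ℕ} (A : Matrix (Fin d) (Fin d) ℝ) (B : Matrix (Fin d) (Fin p) ℝ) : Prop :=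
  ∃ F : Matrix (Fin p) (Fin d) ℝ, IsHurwitz (A + B * F)

section Network

variable {N d p : ℕ} {ι : Type*}

/-- The protocol `u_i = K ∑_j w_ij (x_j - x_i)` on the graph `G`, at the joint state `x`. -/
def agentControl (K : Matrix (Fin p) (Fin d) ℝ) (G : WeightedGraph N) (x : Fin N → Fin d → ℝ)
    (i : Fin N) : Fin p → ℝ :=
  K *ᵥ ∑ j, G.weight i j • (x j - x i)

/-- `x` is a trajectory of the network `x_i' = A x_i + f(x_i) + B u_i` under the protocol with gain
`K` and switching graphs: continuous on `[0, ∞)` and solving the equation away from the switching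
times. -/
structure IsTrajectory (A : Matrix (Fin d) (Fin d) ℝ) (B : Matrix (Fin d) (Fin p) ℝ)
    (f : (Fin d → ℝ) → Fin d → ℝ) (K : Matrix (Fin p) (Fin d) ℝ) (G : ι → WeightedGraph N)
    (σ : SwitchingSignal ι) (x : ℝ → Fin N → Fin d → ℝ) : Prop where
  continuousOn : ContinuousOn x (Set.Ici 0)
  hasDerivAt : ∀ t, 0 < t → t ∉ Set.range σ.times → ∀ i, HasDerivAt (fun s => x s i)
    (A *ᵥ x t i + f (x t i) + B *ᵥ agentControl K (G (σ.signal t)) (x t) i) t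

/-- The energy consumption term plus the consensus regulation term, at the joint state `x`. -/
def runningCost (Q : Matrix (Fin d) (Fin d) ℝ) (R : Matrix (Fin p) (Fin p) ℝ)
    (K : Matrix (Fin p) (Fin d) ℝ) (G : WeightedGraph N) (x : Fin N → Fin d → ℝ) : ℝ :=
  (∑ i, agentControl K G x i ⬝ᵥ R *ᵥ agentControl K G x i) +
    ∑ i, ∑ j, G.weight i j * ((x j - x i) ⬝ᵥ Q *ᵥ (x j - x i))

/-- The total cost `J_C` along `x`, the integral of the running cost over `[0, ∞)`, converges and
is at most `β`. -/
def CostAtMost (Q : Matrix (Fin d) (Fin d) ℝ) (R : Matrix (Fin p) (Fin p) ℝ)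
    (K : Matrix (Fin p) (Fin d) ℝ) (G : ι → WeightedGraph N) (σ : SwitchingSignal ι)
    (x : ℝ → Fin N → Fin d → ℝ) (β : ℝ) : Prop :=
  MeasureTheory.IntegrableOn (fun t => runningCost Q R K (G (σ.signal t)) (x t)) (Set.Ioi 0) ∧
    ∫ t in Set.Ioi (0 : ℝ), runningCost Q R K (G (σ.signal t)) (x t) ≤ β

/-- Guaranteed-cost consensus: for every initial state there are a positive constant `β` and a
consensus function `c` such that all agents approach `c` and `J_C ≤ β`. -/
def AchievesGuaranteedCostConsensus (A : Matrix (Fin d) (Fin d) ℝ) (B : Matrix (Fin d) (Fin p) ℝ)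
    (f : (Fin d → ℝ) → Fin d → ℝ) (Q : Matrix (Fin d) (Fin d) ℝ) (R : Matrix (Fin p) (Fin p) ℝ)
    (K : Matrix (Fin p) (Fin d) ℝ) (G : ι → WeightedGraph N) (σ : SwitchingSignal ι) : Prop :=
  ∀ x₀ : Fin N → Fin d → ℝ, ∃ β : ℝ, 0 < β ∧ ∃ c : ℝ → Fin d → ℝ,
    ∀ x, IsTrajectory A B f K G σ x → x 0 = x₀ →
      (∀ i, Filter.Tendsto (fun t => x t i - c t) Filter.atTop (𝓝 0)) ∧ CostAtMost Q R K G σ x β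

/-- Guaranteed-cost consensualizability: some gain matrix achieves guaranteed-cost consensus. -/
def GuaranteedCostConsensualizable (A : Matrix (Fin d) (Fin d) ℝ) (B : Matrix (Fin d) (Fin p) ℝ)
    (f : (Fin d → ℝ) → Fin d → ℝ) (Q : Matrix (Fin d) (Fin d) ℝ) (R : Matrix (Fin p) (Fin p) ℝ)
    (G : ι → WeightedGraph N) (σ : SwitchingSignal ι) : Prop :=
  ∃ K : Matrix (Fin p) (Fin d) ℝ, AchievesGuaranteedCostConsensus A B f Q R K G σ

/-- The bound `N⁻¹ x₀ᵀ ((N I - 1 1ᵀ) ⊗ P) x₀`, with `x₀` the stacked vector of agent states. -/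
def costBound (P : Matrix (Fin d) (Fin d) ℝ) (x₀ : Fin N → Fin d → ℝ) : ℝ :=
  (N : ℝ)⁻¹ * ((fun q : Fin N × Fin d => x₀ q.1 q.2) ⬝ᵥ
    ((((N : ℝ) • (1 : Matrix (Fin N) (Fin N) ℝ) - Matrix.of fun _ _ => 1) ⊗ₖ P) *ᵥ
      fun q : Fin N × Fin d => x₀ q.1 q.2))

/-- `P` is a symmetric positive definite solution of
`Aᵀ P + P A + P (l² B R Bᵀ - 2 m B Bᵀ) P + 3 l Q = 0`. -/
def IsRiccatiSolution (A : Matrix (Fin d) (Fin d) ℝ) (B : Matrix (Fin d) (Fin p) ℝ)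
    (Q : Matrix (Fin d) (Fin d) ℝ) (R : Matrix (Fin p) (Fin p) ℝ) (m l : ℝ)
    (P : Matrix (Fin d) (Fin d) ℝ) : Prop :=
  P.PosDef ∧
    Aᵀ * P + P * A + P * (l ^ 2 • (B * R * Bᵀ) - (2 * m) • (B * Bᵀ)) * P + (3 * l) • Q = 0

end Network

end

/-! The coupling terms sum to zero over the nodes, so the average state obeys `ẋ = A x` whatever the
switching does, and the deviations `z i` from the average sum to zero and follow the same closed
loop. The storage function is `V = ∑ i, z i ⬝ᵥ P *ᵥ z i` (`disagreement`), which equals `costBound`.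
Put `v i = Bᵀ P z i`, so that the control is the graph coupling of `v`. On vectors summing to zero
every Laplacian of the family lies between `λ_min` and `λ_max`. Hence the coupling contributes at
most `-2 λ_min ∑ |v i|²` to `V'`, the control cost is at most `λ_max² ∑ v iᵀ R v i`, and the
consensus cost is at most `2 λ_max ∑ z iᵀ Q z i`. The Riccati equation cancels all the `v` terms and
leaves `V' + cost ≤ -λ_max ∑ z iᵀ Q z i` (`dissipation`), with constants common to all graphs.
Integration bounds the cost by `V 0`; since `Q` dominates a multiple of `P`, `V` decays
exponentially. The condition on `R` makes `S = 2 λ_min I - λ_max² R` positive definite, so the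
Riccati equation is the standard one with quadratic term `-P B S Bᵀ P`. It is solved algebraically:
`posSemidef_of_lyapunov` compares solutions of Lyapunov inequalities, a stabilizing feedback
provides a subsolution, and a subsolution of least trace must be a solution
(`exists_riccati_eq_zero`). -/

noncomputable section

namespace Matrix

/-! ### Quadratic forms and symmetric pencils. -/

section Pencil

variable {n m : Type*} [Fintype n] [Fintype m]

theorem PosSemidef.dotProduct_nonneg {M : Matrix n n ℝ} (hM : M.PosSemidef) (v : n → ℝ) :
    0 ≤ v ⬝ᵥ M *ᵥ v := by
  simpa using hM.dotProduct_mulVec_nonneg v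

theorem PosDef.dotProduct_pos {M : Matrix n n ℝ} (hM : M.PosDef) {v : n → ℝ} (hv : v ≠ 0) :
    0 < v ⬝ᵥ M *ᵥ v := by
  simpa using hM.dotProduct_mulVec_pos hv

theorem PosSemidef.of_isSymm {M : Matrix n n ℝ} (hM : Mᵀ = M) (h : ∀ v, 0 ≤ v ⬝ᵥ M *ᵥ v) :
    M.PosSemidef :=
  .of_dotProduct_mulVec_nonneg (by simpa [IsHermitian] using hM) (by simpa using h)

theorem PosDef.of_isSymm {M : Matrix n n ℝ} (hM : Mᵀ = M) (h : ∀ v, v ≠ 0 → 0 < v ⬝ᵥ M *ᵥ v) :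
    M.PosDef :=
  .of_dotProduct_mulVec_pos (by simpa [IsHermitian] using hM) (fun v hv => by simpa using h v hv)

theorem PosSemidef.transpose_eq {k : Type*} {M : Matrix k k ℝ} (hM : M.PosSemidef) : Mᵀ = M := by
  simpa [IsHermitian] using hM.isHermitian

theorem PosDef.transpose_eq {k : Type*} {M : Matrix k k ℝ} (hM : M.PosDef) : Mᵀ = M :=
  hM.posSemidef.transpose_eq

theorem dotProduct_mulVec_transpose (M : Matrix m n ℝ) (v : m → ℝ) (w : n → ℝ) :
    v ⬝ᵥ M *ᵥ w = (Mᵀ *ᵥ v) ⬝ᵥ w := by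
  rw [dotProduct_mulVec, mulVec_transpose]

theorem dotProduct_mulVec_comm_of_symm {M : Matrix n n ℝ} (hM : Mᵀ = M) (v w : n → ℝ) :
    v ⬝ᵥ M *ᵥ w = w ⬝ᵥ M *ᵥ v := by
  rw [dotProduct_mulVec_transpose, hM, dotProduct_comm]

/-- The minimum of the generalized Rayleigh quotient of a symmetric pencil is attained, at a
generalized eigenvector. -/
theorem exists_min_rayleigh [Nonempty n] {X Y : Matrix n n ℝ} (hX : X.PosDef) (hY : Yᵀ = Y) :
    ∃ (μ : ℝ) (v : n → ℝ), v ≠ 0 ∧ (Y - μ • X).PosSemidef ∧ Y *ᵥ v = μ • X *ᵥ v := by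
  have hcont (M : Matrix n n ℝ) : Continuous fun v : n → ℝ => v ⬝ᵥ M *ᵥ v := by fun_prop
  have hne {v : n → ℝ} (hv : v ∈ Metric.sphere (0 : n → ℝ) 1) : v ≠ 0 :=
    ne_zero_of_mem_unit_sphere ⟨v, hv⟩
  obtain ⟨v, hv, hmin⟩ := (isCompact_sphere (0 : n → ℝ) 1).exists_isMinOn
    (NormedSpace.sphere_nonempty.2 zero_le_one)
    ((hcont Y).continuousOn.div (hcont X).continuousOn fun v hv =>
      (hX.dotProduct_pos (hne hv)).ne')
  set μ := (v ⬝ᵥ Y *ᵥ v) / (v ⬝ᵥ X *ᵥ v) with hμ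
  have hpsd : (Y - μ • X).PosSemidef := by
    refine .of_isSymm (by simp [hY, hX.transpose_eq]) fun w => ?_
    rcases eq_or_ne w 0 with rfl | hw
    · simp
    have hw' : 0 < ‖w‖ := norm_pos_iff.2 hw
    have hs : ‖w‖⁻¹ • w ∈ Metric.sphere (0 : n → ℝ) 1 := by
      simp [norm_smul, hw'.ne']
    have h := hmin hs
    simp only [Set.mem_ofPred_eq, Pi.div_apply, mulVec_smul, smul_dotProduct, dotProduct_smul,
      smul_eq_mul] at h
    rw [mul_div_mul_left _ _ (by positivity), mul_div_mul_left _ _ (by positivity), ← hμ,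
      le_div_iff₀ (hX.dotProduct_pos hw)] at h
    simp only [sub_mulVec, smul_mulVec, dotProduct_sub, dotProduct_smul, smul_eq_mul]
    linarith
  refine ⟨μ, v, hne hv, hpsd, ?_⟩
  -- A semidefinite form vanishes only on the kernel of its matrix, so the minimizer is a
  -- generalized eigenvector; no Lagrange multiplier is needed.
  have h0 : v ⬝ᵥ (Y - μ • X) *ᵥ v = 0 := by
    simp only [sub_mulVec, smul_mulVec, dotProduct_sub, dotProduct_smul, smul_eq_mul, hμ]
    rw [div_mul_cancel₀ _ (hX.dotProduct_pos (hne hv)).ne', sub_self]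
  have := (hpsd.dotProduct_mulVec_zero_iff v).1 (by simpa using h0)
  rwa [sub_mulVec, smul_mulVec, sub_eq_zero] at this

theorem exists_pos_smul_le [Nonempty n] {X Y : Matrix n n ℝ} (hX : X.PosDef) (hY : Y.PosDef) :
    ∃ μ : ℝ, 0 < μ ∧ ∀ v, μ * (v ⬝ᵥ X *ᵥ v) ≤ v ⬝ᵥ Y *ᵥ v := by
  obtain ⟨μ, v, hv, hpsd, heq⟩ := exists_min_rayleigh hX hY.transpose_eq
  refine ⟨μ, ?_, fun w => ?_⟩
  · have h := hY.dotProduct_pos hv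
    rw [heq, dotProduct_smul, smul_eq_mul] at h
    exact pos_of_mul_pos_left h (hX.dotProduct_pos hv).le
  · have := hpsd.dotProduct_nonneg w
    simp only [sub_mulVec, smul_mulVec, dotProduct_sub, dotProduct_smul, smul_eq_mul] at this
    linarith

theorem exists_le_smul [Nonempty n] {X Y : Matrix n n ℝ} (hX : X.PosDef) (hY : Yᵀ = Y) :
    ∃ c : ℝ, 0 < c ∧ (c • X - Y).PosSemidef := by
  obtain ⟨μ, v, hv, hpsd, heq⟩ := exists_min_rayleigh hX (Y := -Y) (by simp [hY])
  refine ⟨max (-μ) 1, by simp, .of_isSymm (by simp [hX.transpose_eq, hY]) fun w => ?_⟩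
  have h := hpsd.dotProduct_nonneg w
  simp only [sub_mulVec, neg_mulVec, smul_mulVec, dotProduct_sub, dotProduct_neg, dotProduct_smul,
    smul_eq_mul] at h ⊢
  nlinarith [hX.posSemidef.dotProduct_nonneg w, le_max_left (-μ) 1]

end Pencil

/-! ### Lyapunov inequalities and equations. -/

section Lyapunov

variable {n : Type*} [Fintype n]

theorem dotProduct_lyapunov (M : Matrix n n ℝ) {X : Matrix n n ℝ} (hX : Xᵀ = X) (v : n → ℝ) :
    v ⬝ᵥ (Mᵀ * X + X * M) *ᵥ v = 2 * (v ⬝ᵥ X *ᵥ (M *ᵥ v)) := by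
  rw [add_mulVec, dotProduct_add, ← mulVec_mulVec, ← mulVec_mulVec, dotProduct_mulVec_transpose,
    transpose_transpose, dotProduct_mulVec_comm_of_symm hX]
  ring

/-- `M` admits the strict Lyapunov function `X`. -/
def IsLyapunov (M X : Matrix n n ℝ) : Prop :=
  X.PosDef ∧ (-(Mᵀ * X + X * M)).PosDef

/-- Comparison principle for the Lyapunov operator. -/
theorem IsLyapunov.posSemidef_of_lyapunov [Nonempty n] {M X Y : Matrix n n ℝ} (h : IsLyapunov M X)
    (hY : Yᵀ = Y) (hle : (-(Mᵀ * Y + Y * M)).PosSemidef) : Y.PosSemidef := by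
  obtain ⟨μ, v, hv, hpsd, heq⟩ := exists_min_rayleigh h.1 hY
  have h1 := hle.dotProduct_nonneg v
  have h2 := h.2.dotProduct_pos hv
  rw [neg_mulVec, dotProduct_neg, dotProduct_lyapunov _ hY] at h1
  rw [neg_mulVec, dotProduct_neg, dotProduct_lyapunov _ h.1.transpose_eq] at h2
  -- At the minimizing eigenvector `Y v = μ X v`, so the two Lyapunov forms differ by the factor
  -- `μ`. The one for `X` is strictly negative and the one for `Y` nonpositive, hence `μ ≥ 0`.
  have h3 : v ⬝ᵥ Y *ᵥ (M *ᵥ v) = μ * (v ⬝ᵥ X *ᵥ (M *ᵥ v)) := by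
    rw [dotProduct_mulVec_comm_of_symm hY, heq, dotProduct_smul, smul_eq_mul,
      dotProduct_mulVec_comm_of_symm h.1.transpose_eq]
  have hμ : 0 ≤ μ := by
    rw [h3] at h1
    nlinarith
  refine .of_isSymm hY fun w => ?_
  have := hpsd.dotProduct_nonneg w
  simp only [sub_mulVec, smul_mulVec, dotProduct_sub, dotProduct_smul, smul_eq_mul] at this
  nlinarith [h.1.posSemidef.dotProduct_nonneg w]

theorem PosSemidef.eq_zero_of_neg {M : Matrix n n ℝ} (h : M.PosSemidef) (h' : (-M).PosSemidef) :
    M = 0 := by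
  refine h.trace_eq_zero_iff.1 (le_antisymm ?_ h.trace_nonneg)
  have := h'.trace_nonneg
  rw [trace_neg] at this
  linarith

/-- On the finite-dimensional space of symmetric matrices the Lyapunov operator is injective, by the
comparison principle applied to `Y` and `-Y`, and therefore surjective. -/
theorem IsLyapunov.exists_solution [Nonempty n] {M X W : Matrix n n ℝ} (h : IsLyapunov M X)
    (hW : Wᵀ = W) : ∃ Y : Matrix n n ℝ, Yᵀ = Y ∧ Mᵀ * Y + Y * M = W := by
  let E : Submodule ℝ (Matrix n n ℝ) :=
    { carrier := {Y | Yᵀ = Y}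
      add_mem' := fun {a b} ha hb => by
        simp only [Set.mem_ofPred_eq] at *
        rw [transpose_add, ha, hb]
      zero_mem' := by simp
      smul_mem' := fun c a ha => by
        simp only [Set.mem_ofPred_eq] at *
        rw [transpose_smul, ha] }
  have hmem (Y : Matrix n n ℝ) : Y ∈ E ↔ Yᵀ = Y := Iff.rfl
  let T : E →ₗ[ℝ] E :=
    { toFun := fun Y => ⟨Mᵀ * Y.1 + Y.1 * M, by
        rw [hmem, transpose_add, transpose_mul, transpose_mul, (hmem _).1 Y.2, transpose_transpose,
          add_comm]⟩
      map_add' := fun Y Z => Subtype.ext <| by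
        simp only [Submodule.coe_add, mul_add, add_mul]; abel
      map_smul' := fun c Y => Subtype.ext <| by simp }
  have hinj : Function.Injective T := by
    rw [injective_iff_map_eq_zero]
    rintro ⟨Y, hY⟩ h0
    have h0' : Mᵀ * Y + Y * M = 0 := congrArg Subtype.val h0
    have h1 := h.posSemidef_of_lyapunov hY (by rw [h0', neg_zero]; exact .zero)
    have h2 := h.posSemidef_of_lyapunov (Y := -Y) (by rw [transpose_neg, (hmem _).1 hY])
      (by rw [mul_neg, neg_mul, ← neg_add, h0', neg_zero, neg_zero]; exact .zero)
    exact Subtype.ext (h1.eq_zero_of_neg h2)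
  obtain ⟨⟨Y, hY⟩, hYW⟩ := LinearMap.surjective_of_injective hinj ⟨W, hW⟩
  exact ⟨Y, hY, congrArg Subtype.val hYW⟩

end Lyapunov

/-! ### The algebraic Riccati equation. -/

section Riccati

variable {n m : Type*} [Fintype n] [Fintype m]

/-- The Riccati operator `P ↦ Aᵀ P + P A - P B Bᵀ P + Q`. -/
def riccati (A : Matrix n n ℝ) (B : Matrix n m ℝ) (Q P : Matrix n n ℝ) : Matrix n n ℝ :=
  Aᵀ * P + P * A - P * (B * Bᵀ) * P + Q

variable {A : Matrix n n ℝ} {B : Matrix n m ℝ} {Q : Matrix n n ℝ}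

theorem posSemidef_mul_gram_mul (B : Matrix n m ℝ) {P : Matrix n n ℝ} (hP : Pᵀ = P) :
    (P * (B * Bᵀ) * P).PosSemidef := by
  have := posSemidef_self_mul_conjTranspose (P * B)
  rwa [conjTranspose_eq_transpose_of_trivial, transpose_mul, hP, ← Matrix.mul_assoc,
    Matrix.mul_assoc P B Bᵀ] at this

/-- A positive semidefinite subsolution is a strict Lyapunov function of its closed loop. -/
theorem isLyapunov_closedLoop (hQ : Q.PosDef) {P : Matrix n n ℝ} (hP : P.PosSemidef)
    (hle : (-riccati A B Q P).PosSemidef) : IsLyapunov (A - B * Bᵀ * P) P := by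
  have hPt := hP.transpose_eq
  constructor
  · refine .of_isSymm hPt fun v hv => lt_of_le_of_ne (hP.dotProduct_nonneg v) fun h0 => ?_
    -- On a kernel vector of `P` the Riccati form reduces to that of `Q`, which is positive: this
    -- contradicts the subsolution inequality.
    have hPv : P *ᵥ v = 0 := (hP.dotProduct_mulVec_zero_iff v).1 (by simpa using h0.symm)
    have h := hle.dotProduct_nonneg v
    have e : v ⬝ᵥ (Aᵀ * P + P * A - P * (B * Bᵀ) * P + Q) *ᵥ v = v ⬝ᵥ Q *ᵥ v := by
      rw [add_mulVec, sub_mulVec, dotProduct_add, dotProduct_sub, dotProduct_lyapunov _ hPt,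
        ← mulVec_mulVec v _ P, dotProduct_mulVec_comm_of_symm hPt, hPv]
      simp
    rw [neg_mulVec, dotProduct_neg, riccati, e] at h
    linarith [hQ.dotProduct_pos hv]
  · have e : -((A - B * Bᵀ * P)ᵀ * P + P * (A - B * Bᵀ * P)) =
        Q + P * (B * Bᵀ) * P + -riccati A B Q P := by
      simp only [riccati, transpose_sub, transpose_mul, transpose_transpose, hPt, Matrix.mul_sub,
        Matrix.sub_mul, Matrix.mul_assoc]
      abel
    rw [e]
    exact (hQ.add_posSemidef (posSemidef_mul_gram_mul B hPt)).add_posSemidef hle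

/-- The difference of two solutions satisfies a Lyapunov equation for the closed loop of one of
them, with right-hand side `-(P - P') B Bᵀ (P - P')`. Comparison gives `P ≥ P'`, and the roles can
be exchanged. -/
theorem riccati_unique [Nonempty n] (hQ : Q.PosDef) {P P' : Matrix n n ℝ} (hP : P.PosSemidef)
    (hP' : P'.PosSemidef) (h : riccati A B Q P = 0) (h' : riccati A B Q P' = 0) : P = P' := by
  have key {P P' : Matrix n n ℝ} (hP : P.PosSemidef) (hP' : P'.PosSemidef)
      (h : riccati A B Q P = 0) (h' : riccati A B Q P' = 0) : (P - P').PosSemidef := by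
    have hL := isLyapunov_closedLoop hQ hP (by rw [h, neg_zero]; exact .zero)
    have ht : (P - P')ᵀ = P - P' := by rw [transpose_sub, hP.transpose_eq, hP'.transpose_eq]
    refine hL.posSemidef_of_lyapunov ht ?_
    have e : -((A - B * Bᵀ * P)ᵀ * (P - P') + (P - P') * (A - B * Bᵀ * P)) =
        (P - P') * (B * Bᵀ) * (P - P') + riccati A B Q P' - riccati A B Q P := by
      simp only [riccati, transpose_sub, transpose_mul, transpose_transpose, hP.transpose_eq,
        Matrix.mul_sub, Matrix.sub_mul, Matrix.mul_assoc]
      abel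
    rw [e, h, h', add_zero, sub_zero]
    exact posSemidef_mul_gram_mul B ht
  exact sub_eq_zero.1 ((key hP hP' h h').eq_zero_of_neg (by rw [neg_sub]; exact key hP' hP h' h))

/-- Testing on `e_i ± e_j` gives `2 |P i j| ≤ P i i + P j j`. This makes the set of subsolutions of
bounded trace compact. -/
theorem PosSemidef.abs_apply_le_trace {P : Matrix n n ℝ} (hP : P.PosSemidef) (i j : n) :
    |P i j| ≤ P.trace := by
  classical
  have hdiag (i : n) : P i i ≤ P.trace :=
    Finset.single_le_sum (f := fun i => P i i) (fun i _ => hP.diag_nonneg) (Finset.mem_univ i)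
  have hs : P j i = P i j := congrFun (congrFun hP.transpose_eq i) j
  have h1 := hP.dotProduct_nonneg (Pi.single i 1 + Pi.single j 1)
  have h2 := hP.dotProduct_nonneg (Pi.single i 1 - Pi.single j 1)
  simp [mulVec_add, mulVec_sub, dotProduct_add, dotProduct_sub, hs] at h1 h2
  rw [abs_le]
  constructor <;> linarith [hdiag i, hdiag j]

theorem isClosed_posSemidef : IsClosed {P : Matrix n n ℝ | P.PosSemidef} := by
  have : {P : Matrix n n ℝ | P.PosSemidef} =
      {P | Pᵀ = P} ∩ ⋂ v : n → ℝ, {P | 0 ≤ v ⬝ᵥ P *ᵥ v} := by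
    ext P
    simp only [Set.mem_ofPred_eq, Set.mem_inter_iff, Set.mem_iInter]
    exact ⟨fun h => ⟨h.transpose_eq, h.dotProduct_nonneg⟩, fun h => .of_isSymm h.1 h.2⟩
  rw [this]
  refine (isClosed_eq (by fun_prop) continuous_id).inter (isClosed_iInter fun v => ?_)
  exact isClosed_le continuous_const (by fun_prop)

theorem isCompact_subsolutions (A : Matrix n n ℝ) (B : Matrix n m ℝ) (Q : Matrix n n ℝ) (c : ℝ) :
    IsCompact {P : Matrix n n ℝ | P.PosSemidef ∧ (-riccati A B Q P).PosSemidef ∧ P.trace ≤ c} := by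
  have hbox : IsCompact (Set.univ.pi fun _ : n => Set.univ.pi fun _ : n => Set.Icc (-c) c) :=
    isCompact_univ_pi fun _ => isCompact_univ_pi fun _ => isCompact_Icc
  refine IsCompact.of_isClosed_subset (X := n → n → ℝ) hbox ?_ ?_
  · refine isClosed_posSemidef.inter (IsClosed.inter ?_ ?_)
    · exact isClosed_posSemidef.preimage (f := fun P => -riccati A B Q P)
        (by unfold riccati; fun_prop)
    · exact isClosed_le (f := fun P : Matrix n n ℝ => P.trace) (by fun_prop) continuous_const
  · rintro P ⟨hP, -, hc⟩ i - j -
    exact abs_le.1 ((hP.abs_apply_le_trace i j).trans hc)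

/-- A stabilizing feedback yields a positive semidefinite subsolution of the Riccati equation. -/
theorem exists_subsolution [Nonempty n] (hQ : Q.PosDef) {F : Matrix m n ℝ} {X : Matrix n n ℝ}
    (h : IsLyapunov (A + B * F) X) :
    ∃ P : Matrix n n ℝ, P.PosSemidef ∧ (-riccati A B Q P).PosSemidef := by
  -- Scaling `X` lets its Lyapunov decrease absorb `Fᵀ F + Q`; the rest of `-riccati` is a completed
  -- square.
  obtain ⟨c, hc, hpsd⟩ := exists_le_smul h.2 (Y := Fᵀ * F + Q)
    (by simp [hQ.transpose_eq])
  have hPt : (c • X)ᵀ = c • X := by rw [transpose_smul, h.1.transpose_eq]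
  refine ⟨c • X, h.1.posSemidef.smul hc.le, ?_⟩
  have e : -riccati A B Q (c • X) =
      (c • -((A + B * F)ᵀ * X + X * (A + B * F)) - (Fᵀ * F + Q)) +
        (F + Bᵀ * (c • X))ᵀ * (F + Bᵀ * (c • X)) := by
    simp only [riccati, transpose_add, transpose_mul, transpose_transpose, transpose_smul,
      h.1.transpose_eq, Matrix.mul_add, Matrix.add_mul, Matrix.mul_assoc, smul_neg, smul_add,
      Matrix.mul_smul, Matrix.smul_mul]
    abel
  rw [e]
  exact hpsd.add (posSemidef_conjTranspose_mul_self _)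

/-- Take a subsolution `P` of least trace and let `P'` be its Newton (Kleinman) iterate, the
solution of the Lyapunov equation of the closed loop of `P`. Then `P'` is again a subsolution and
`P' ≤ P`, so minimality forces `P' = P`, and a fixed point of the iteration solves the equation. -/
theorem exists_riccati_eq_zero [Nonempty n] (hQ : Q.PosDef) {F : Matrix m n ℝ} {X : Matrix n n ℝ}
    (h : IsLyapunov (A + B * F) X) :
    ∃ P : Matrix n n ℝ, P.PosDef ∧ riccati A B Q P = 0 := by
  obtain ⟨P₀, hP₀, hP₀'⟩ := exists_subsolution hQ h
  obtain ⟨P, ⟨hP, hle, htr⟩, hmin⟩ := (isCompact_subsolutions A B Q P₀.trace).exists_isMinOn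
    ⟨P₀, hP₀, hP₀', le_rfl⟩ (f := trace) (by fun_prop)
  have hL := isLyapunov_closedLoop hQ hP hle
  have hPt := hP.transpose_eq
  have hM := posSemidef_mul_gram_mul B hPt
  obtain ⟨P', hPt', hP'eq⟩ := hL.exists_solution (W := -(Q + P * (B * Bᵀ) * P))
    (by rw [transpose_neg, transpose_add, hQ.transpose_eq, hM.transpose_eq])
  have hP' : P'.PosSemidef := hL.posSemidef_of_lyapunov hPt'
    (by rw [hP'eq, neg_neg]; exact hQ.posSemidef.add hM)
  -- The Riccati operator is quadratic, so the residual after a Newton step is exactly its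
  -- second-order term.
  have hric : -riccati A B Q P' = (P' - P) * (B * Bᵀ) * (P' - P) := by
    rw [neg_eq_iff_add_eq_zero]
    have : riccati A B Q P' + (P' - P) * (B * Bᵀ) * (P' - P) =
        (A - B * Bᵀ * P)ᵀ * P' + P' * (A - B * Bᵀ * P) + (Q + P * (B * Bᵀ) * P) := by
      simp only [riccati, transpose_sub, transpose_mul, transpose_transpose, hPt,
        Matrix.mul_sub, Matrix.sub_mul, Matrix.mul_assoc]
      abel
    rw [this, hP'eq, neg_add_cancel]
  have hsub : (P' - P)ᵀ = P' - P := by rw [transpose_sub, hPt, hPt']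
  have hdiff : (A - B * Bᵀ * P)ᵀ * (P - P') + (P - P') * (A - B * Bᵀ * P) = riccati A B Q P := by
    have : (A - B * Bᵀ * P)ᵀ * (P - P') + (P - P') * (A - B * Bᵀ * P) =
        riccati A B Q P - (Q + P * (B * Bᵀ) * P) -
          ((A - B * Bᵀ * P)ᵀ * P' + P' * (A - B * Bᵀ * P)) := by
      simp only [riccati, transpose_sub, transpose_mul, transpose_transpose, hPt,
        Matrix.mul_sub, Matrix.sub_mul, Matrix.mul_assoc]
      abel
    rw [this, hP'eq]
    abel
  have hPP' : (P - P').PosSemidef :=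
    hL.posSemidef_of_lyapunov (by rw [transpose_sub, hPt, hPt']) (by rw [hdiff]; exact hle)
  have htr' : P'.trace ≤ P.trace := by
    have := hPP'.trace_nonneg
    rw [trace_sub] at this
    linarith
  have hge : P.trace ≤ P'.trace := hmin ⟨hP',
    by rw [hric]; exact posSemidef_mul_gram_mul B hsub, htr'.trans htr⟩
  have h0 : P - P' = 0 := hPP'.trace_eq_zero_iff.1 (by rw [trace_sub]; linarith)
  refine ⟨P, hL.1, ?_⟩
  rw [← hdiff, h0]
  simp

end Riccati

end Matrix

namespace Matrix

/-! ### Lyapunov functions of Hurwitz matrices. -/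

section Hurwitz

open scoped Matrix.Norms.L2Operator

/-- Gelfand's formula: the roots `‖C ^ k‖ ^ (1 / k)` tend to the spectral radius, which is below
one. -/
theorem exists_norm_pow_lt_one {n : Type*} [Fintype n] [DecidableEq n] [Nonempty n]
    (C : Matrix n n ℂ) (hC : ∀ z ∈ spectrum ℂ C, ‖z‖ < 1) : ∃ k : ℕ, ‖C ^ k‖ < 1 := by
  have : CompleteSpace (Matrix n n ℂ) := FiniteDimensional.complete ℂ _
  have hr : spectralRadius ℂ C < (1 : NNReal) :=
    spectrum.spectralRadius_lt_of_forall_lt C fun z hz => by exact_mod_cast hC z hz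
  have ht := spectrum.pow_nnnorm_pow_one_div_tendsto_nhds_spectralRadius C
  obtain ⟨k, hk, hk0⟩ := ((ht.eventually_lt_const hr).and (Filter.eventually_gt_atTop 0)).exists
  refine ⟨k, ?_⟩
  by_contra! h
  have h1 : (1 : ENNReal) ≤ (‖C ^ k‖₊ : ENNReal) := by exact_mod_cast h
  exact absurd hk (not_lt.2 (by simpa using ENNReal.one_le_rpow h1 (by positivity)))

theorem dotProduct_self_mulVec_lt {n : Type*} [Fintype n] [DecidableEq n] (C : Matrix n n ℝ)
    (hC : ‖C.map (algebraMap ℝ ℂ)‖ < 1) {v : n → ℝ} (hv : v ≠ 0) :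
    (C *ᵥ v) ⬝ᵥ (C *ᵥ v) < v ⬝ᵥ v := by
  have hnorm (u : n → ℝ) :
      ‖WithLp.toLp 2 (fun i => algebraMap ℝ ℂ (u i))‖ ^ 2 = u ⬝ᵥ u := by
    rw [EuclideanSpace.norm_sq_eq]
    simp [dotProduct, sq]
  have h := l2_opNorm_mulVec (C.map (algebraMap ℝ ℂ))
    (WithLp.toLp 2 (fun i => algebraMap ℝ ℂ (v i)))
  have hmap : (C.map (algebraMap ℝ ℂ)) *ᵥ (fun i => algebraMap ℝ ℂ (v i)) =
      fun i => algebraMap ℝ ℂ ((C *ᵥ v) i) := by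
    ext i
    exact ((algebraMap ℝ ℂ).map_mulVec C v i).symm
  simp only [hmap] at h
  have hpos : 0 < v ⬝ᵥ v := by simpa using PosDef.one.dotProduct_pos hv
  rw [← hnorm] at hpos
  rw [← hnorm, ← hnorm]
  have hv0 : 0 < ‖WithLp.toLp 2 (fun i => algebraMap ℝ ℂ (v i))‖ := by
    refine lt_of_le_of_ne (norm_nonneg _) fun h0 => ?_
    rw [← h0] at hpos
    simp at hpos
  exact pow_lt_pow_left₀ (h.trans_lt (mul_lt_of_lt_one_left hv0 hC)) (norm_nonneg _) two_ne_zero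

/-- `|1 + ε z|² = 1 + ε (2 Re z + ε |z|²)`, and the bracket is negative for small `ε > 0`. -/
theorem exists_contraction_of_re_neg {s : Set ℂ} (hs : s.Finite) (hneg : ∀ z ∈ s, z.re < 0) :
    ∃ ε : ℝ, 0 < ε ∧ ∀ z ∈ s, ‖1 + (ε : ℂ) * z‖ < 1 := by
  have hev : ∀ᶠ ε : ℝ in 𝓝[>] 0, ∀ z ∈ s, ‖1 + (ε : ℂ) * z‖ < 1 := by
    refine (Filter.eventually_all_finite hs).2 fun z hz => ?_
    have hlim : Filter.Tendsto (fun ε : ℝ => 2 * z.re + ε * Complex.normSq z) (𝓝[>] 0)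
        (𝓝 (2 * z.re + 0 * Complex.normSq z)) :=
      (Continuous.tendsto (by fun_prop) 0).mono_left nhdsWithin_le_nhds
    filter_upwards [hlim.eventually_lt_const (u := 0) (by linarith [hneg z hz]),
      self_mem_nhdsWithin] with ε hε hε0
    rw [← sq_lt_one_iff₀ (norm_nonneg _), ← Complex.normSq_eq_norm_sq, Complex.normSq_apply]
    rw [Complex.normSq_apply] at hε
    simp only [Complex.add_re, Complex.one_re, Complex.mul_re, Complex.ofReal_re,
      Complex.ofReal_im, Complex.add_im, Complex.one_im, Complex.mul_im]
    have := mul_neg_of_pos_of_neg (Set.mem_Ioi.1 hε0) hε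
    nlinarith
  obtain ⟨ε, hε, hε0⟩ := (hev.and self_mem_nhdsWithin).exists
  exact ⟨ε, hε0, hε⟩

/-- Lyapunov's theorem: a Hurwitz matrix admits a strict quadratic Lyapunov function. -/
theorem exists_isLyapunov {d : ℕ} [Nonempty (Fin d)] {M : Matrix (Fin d) (Fin d) ℝ}
    (hM : IsHurwitz M) : ∃ X, IsLyapunov M X := by
  obtain ⟨ε, hε, hz⟩ := exists_contraction_of_re_neg (finite_spectrum _) hM
  -- An Euler step `1 + ε M` passes to discrete time. There a finite sum over powers below `k`
  -- serves as Lyapunov function, since it telescopes along one step and `C ^ k` is a contraction;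
  -- no matrix exponential or improper integral is involved.
  set C : Matrix (Fin d) (Fin d) ℝ := 1 + ε • M with hC
  have hCmap : C.map (algebraMap ℝ ℂ) =
      algebraMap ℂ _ 1 + (ε : ℂ) • M.map (algebraMap ℝ ℂ) := by
    rw [map_one]
    ext i j
    by_cases hij : i = j <;> simp [hC, hij]
  have hspec : ∀ z ∈ spectrum ℂ (C.map (algebraMap ℝ ℂ)), ‖z‖ < 1 := by
    intro z hzC
    rw [hCmap, ← spectrum.singleton_add_eq, Set.singleton_add] at hzC
    obtain ⟨y, hy, rfl⟩ := hzC
    have hε' : IsUnit (ε : ℂ) := by simpa using hε.ne'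
    have hu := spectrum.unit_smul_eq_smul (R := ℂ) (M.map (algebraMap ℝ ℂ)) hε'.unit
    rw [show (ε : ℂ) • M.map (algebraMap ℝ ℂ) = hε'.unit • M.map (algebraMap ℝ ℂ) from rfl, hu]
      at hy
    obtain ⟨x, hx, rfl⟩ := hy
    exact hz x hx
  obtain ⟨k, hk⟩ := exists_norm_pow_lt_one _ hspec
  have hmappow : (C ^ k).map (algebraMap ℝ ℂ) = C.map (algebraMap ℝ ℂ) ^ k :=
    map_pow (algebraMap ℝ ℂ).mapMatrix C k
  rw [← hmappow] at hk
  set X : Matrix (Fin d) (Fin d) ℝ := ∑ j ∈ Finset.range k, (C ^ j)ᵀ * C ^ j with hX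
  have hXt : Xᵀ = X := by simp [hX, transpose_sum]
  have hXq (v : Fin d → ℝ) :
      v ⬝ᵥ X *ᵥ v = ∑ j ∈ Finset.range k, (C ^ j *ᵥ v) ⬝ᵥ (C ^ j *ᵥ v) := by
    simp only [hX, sum_mulVec, dotProduct_sum, ← mulVec_mulVec]
    refine Finset.sum_congr rfl fun j _ => ?_
    rw [dotProduct_mulVec_transpose, transpose_transpose]
  have hstep (v : Fin d → ℝ) : (C *ᵥ v) ⬝ᵥ X *ᵥ (C *ᵥ v) - v ⬝ᵥ X *ᵥ v =
      (C ^ k *ᵥ v) ⬝ᵥ (C ^ k *ᵥ v) - v ⬝ᵥ v := by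
    have := Finset.sum_range_sub (fun j => (C ^ j *ᵥ v) ⬝ᵥ (C ^ j *ᵥ v)) k
    simp only [pow_zero, one_mulVec] at this
    rw [hXq, hXq, ← this, Finset.sum_sub_distrib]
    simp only [mulVec_mulVec, ← pow_succ]
  have hsq (u : Fin d → ℝ) : 0 ≤ u ⬝ᵥ u := by
    simpa using (PosSemidef.one (n := Fin d) (R := ℝ)).dotProduct_nonneg u
  have hXpos (v : Fin d → ℝ) : 0 ≤ v ⬝ᵥ X *ᵥ v := by
    rw [hXq]
    exact Finset.sum_nonneg fun j _ => hsq _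
  refine ⟨X, .of_isSymm hXt fun v hv => ?_, .of_isSymm ?_ fun v hv => ?_⟩
  · have h1 := hstep v
    have h2 := dotProduct_self_mulVec_lt _ hk hv
    linarith [hXpos (C *ᵥ v)]
  · simp [transpose_mul, hXt, add_comm]
  · have h1 := hstep v
    have h2 := dotProduct_self_mulVec_lt _ hk hv
    -- The term of order `ε²` is nonnegative, so the decrease over one Euler step forces the term of
    -- order `ε`, the Lyapunov form of `M`, to be negative.
    have h3 : (C *ᵥ v) ⬝ᵥ X *ᵥ (C *ᵥ v) = v ⬝ᵥ X *ᵥ v + 2 * ε * (v ⬝ᵥ X *ᵥ (M *ᵥ v)) +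
        ε ^ 2 * ((M *ᵥ v) ⬝ᵥ X *ᵥ (M *ᵥ v)) := by
      simp only [hC, add_mulVec, one_mulVec, smul_mulVec, mulVec_add, mulVec_smul, add_dotProduct,
        dotProduct_add, smul_dotProduct, dotProduct_smul, smul_eq_mul]
      rw [dotProduct_mulVec_comm_of_symm hXt (M *ᵥ v) v]
      ring
    rw [neg_mulVec, dotProduct_neg, dotProduct_lyapunov _ hXt]
    have h4 := mul_nonneg (sq_nonneg ε) (hXpos (M *ᵥ v))
    have h5 : ε * (2 * (v ⬝ᵥ X *ᵥ (M *ᵥ v))) < 0 := by linarith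
    have := neg_of_mul_neg_right h5 hε.le
    linarith

end Hurwitz

section Stabilizable

variable {d p : ℕ}

/-- Existence and uniqueness for the algebraic Riccati equation of a stabilizable pair, with a
positive definite control weight `S`. -/
theorem existsUnique_riccati_of_isStabilizable [Nonempty (Fin d)] {A : Matrix (Fin d) (Fin d) ℝ}
    {B : Matrix (Fin d) (Fin p) ℝ} (hAB : IsStabilizable A B) {Q : Matrix (Fin d) (Fin d) ℝ}
    {S : Matrix (Fin p) (Fin p) ℝ} (hQ : Q.PosDef) (hS : S.PosDef) :
    ∃ P : Matrix (Fin d) (Fin d) ℝ,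
      (P.PosDef ∧ Aᵀ * P + P * A - P * (B * S * Bᵀ) * P + Q = 0) ∧
      ∀ P' : Matrix (Fin d) (Fin d) ℝ,
        P'.PosDef → Aᵀ * P' + P' * A - P' * (B * S * Bᵀ) * P' + Q = 0 → P' = P := by
  obtain ⟨F, hF⟩ := hAB
  obtain ⟨X, hX⟩ := exists_isLyapunov hF
  -- The weight is absorbed into the input matrix `B D`; as `D` is invertible, the feedback `D⁻¹ F`
  -- produces the same closed loop.
  obtain ⟨D, hD, hDS⟩ : ∃ D : Matrix (Fin p) (Fin p) ℝ, IsUnit D ∧ S = D * Dᵀ := by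
    open scoped MatrixOrder in
    obtain ⟨D, hD⟩ := CStarAlgebra.nonneg_iff_eq_mul_star_self.1 hS.posSemidef.nonneg
    refine ⟨D, ?_, hD⟩
    have := hS.isUnit
    rw [hD] at this
    exact isUnit_of_mul_isUnit_left this
  have hBS : B * S * Bᵀ = B * D * (B * D)ᵀ := by
    rw [hDS, transpose_mul]
    simp only [Matrix.mul_assoc]
  have hBD : B * D * (D⁻¹ * F) = B * F := by
    rw [Matrix.mul_assoc, mul_nonsing_inv_cancel_left _ _ ((isUnit_iff_isUnit_det _).1 hD)]
  rw [hBS]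
  obtain ⟨P, hP, hP0⟩ := exists_riccati_eq_zero (B := B * D) (F := D⁻¹ * F) hQ
    (by rw [hBD]; exact hX)
  exact ⟨P, ⟨hP, hP0⟩, fun P' hP' h0 => riccati_unique hQ hP'.posSemidef hP.posSemidef h0 hP0⟩

end Stabilizable

end Matrix

namespace Matrix

/-! ### Spectral bounds orthogonal to a kernel vector. -/

section Eigenvalues

variable {n : ℕ} {M : Matrix (Fin n) (Fin n) ℝ}

theorem IsHermitian.sum_coord_mul_coord (hM : M.IsHermitian) (v w : Fin n → ℝ) :
    ∑ i, (hM.eigenvectorBasis i ⬝ᵥ v) * (hM.eigenvectorBasis i ⬝ᵥ w) = v ⬝ᵥ w := by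
  have h := hM.eigenvectorBasis.sum_inner_mul_inner (WithLp.toLp 2 v) (WithLp.toLp 2 w)
  simp only [EuclideanSpace.inner_eq_star_dotProduct, star_trivial] at h
  rw [dotProduct_comm v w, ← h]
  exact Finset.sum_congr rfl fun i _ => by rw [dotProduct_comm w]

theorem IsHermitian.coord_mulVec (hM : M.IsHermitian) (i : Fin n) (v : Fin n → ℝ) :
    hM.eigenvectorBasis i ⬝ᵥ M *ᵥ v = hM.eigenvalues i * (hM.eigenvectorBasis i ⬝ᵥ v) := by
  have ht : Mᵀ = M := by simpa [IsHermitian] using hM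
  rw [dotProduct_mulVec_transpose, ht, hM.mulVec_eigenvectorBasis, smul_dotProduct, smul_eq_mul]

theorem IsHermitian.eigenvalues_le_largestEigenvalue (hM : M.IsHermitian) (i : Fin n) :
    hM.eigenvalues i ≤ largestEigenvalue hM :=
  le_ciSup (Set.finite_range _).bddAbove i

theorem IsHermitian.secondSmallestEigenvalue_le_largestEigenvalue (hn : 2 ≤ n)
    (hM : M.IsHermitian) : secondSmallestEigenvalue hn hM ≤ largestEigenvalue hM := by
  -- This is the reindexing by which `eigenvalues` is defined from `eigenvalues₀`, so the
  -- identification below is `rfl`.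
  let e : Fin (Fintype.card (Fin n)) ≃ Fin n := Fintype.equivOfCardEq (Fintype.card_fin _)
  have hc : Fintype.card (Fin n) = n := Fintype.card_fin n
  have h := hM.eigenvalues_le_largestEigenvalue (e ⟨n - 2, by omega⟩)
  rwa [show hM.eigenvalues (e ⟨n - 2, by omega⟩) = hM.eigenvalues₀ (e.symm (e ⟨n - 2, by omega⟩))
    from rfl, e.symm_apply_apply] at h

theorem IsHermitian.dotProduct_mulVec_le (hM : M.IsHermitian) (v : Fin n → ℝ) :
    v ⬝ᵥ M *ᵥ v ≤ largestEigenvalue hM * (v ⬝ᵥ v) := by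
  rw [← hM.sum_coord_mul_coord v (M *ᵥ v), ← hM.sum_coord_mul_coord v v, Finset.mul_sum]
  refine Finset.sum_le_sum fun i _ => ?_
  rw [hM.coord_mulVec]
  nlinarith [hM.eigenvalues_le_largestEigenvalue i, mul_self_nonneg (hM.eigenvectorBasis i ⬝ᵥ v)]

theorem IsHermitian.exists_forall_ne_secondSmallestEigenvalue_le (hn : 2 ≤ n)
    (hM : M.IsHermitian) :
    ∃ i₀, ∀ i, i ≠ i₀ → secondSmallestEigenvalue hn hM ≤ hM.eigenvalues i := by
  let e : Fin (Fintype.card (Fin n)) ≃ Fin n := Fintype.equivOfCardEq (Fintype.card_fin _)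
  have hc : Fintype.card (Fin n) = n := Fintype.card_fin n
  -- The list `eigenvalues₀` is decreasing, so its last index `n - 1` is the one left out and all
  -- others are at most `n - 2`.
  refine ⟨e ⟨n - 1, by omega⟩, fun i hi => hM.eigenvalues₀_antitone ?_⟩
  have hne : e.symm i ≠ ⟨n - 1, by omega⟩ := fun h => hi (by rw [← h, e.apply_symm_apply])
  have h1 := (e.symm i).isLt
  have h2 : (e.symm i).1 ≠ n - 1 := fun h => hne (Fin.ext h)
  change (e.symm i).1 ≤ n - 2
  omega

/-- A kernel vector spans the eigendirection left out by a positive second smallest eigenvalue. -/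
theorem IsHermitian.coord_eq_zero_of_kernel (hM : M.IsHermitian) {i₀ : Fin n}
    (hpos : ∀ i, i ≠ i₀ → 0 < hM.eigenvalues i) {u v : Fin n → ℝ} (hu : u ≠ 0) (hMu : M *ᵥ u = 0)
    (huv : u ⬝ᵥ v = 0) : hM.eigenvectorBasis i₀ ⬝ᵥ v = 0 := by
  have hzero (i : Fin n) (hi : i ≠ i₀) : hM.eigenvectorBasis i ⬝ᵥ u = 0 := by
    have h := hM.coord_mulVec i u
    rw [hMu, dotProduct_zero, eq_comm, mul_eq_zero] at h
    exact h.resolve_left (hpos i hi).ne'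
  have hsum (w : Fin n → ℝ) :
      (hM.eigenvectorBasis i₀ ⬝ᵥ u) * (hM.eigenvectorBasis i₀ ⬝ᵥ w) = u ⬝ᵥ w := by
    rw [← hM.sum_coord_mul_coord u w, Finset.sum_eq_single i₀ (fun i _ hi => by
      rw [hzero i hi, zero_mul]) (by simp)]
  have hu0 : hM.eigenvectorBasis i₀ ⬝ᵥ u ≠ 0 := fun h => by
    have := hsum u
    rw [h, zero_mul, eq_comm, dotProduct_self_eq_zero] at this
    exact hu this
  have := hsum v
  rw [huv] at this
  exact (mul_eq_zero.1 this).resolve_left hu0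

variable (hn : 2 ≤ n) (hM : M.IsHermitian) (hpos : 0 < secondSmallestEigenvalue hn hM)
  {u v : Fin n → ℝ} (hu : u ≠ 0) (hMu : M *ᵥ u = 0) (huv : u ⬝ᵥ v = 0)
include hpos hu hMu huv

theorem IsHermitian.secondSmallestEigenvalue_mul_le :
    secondSmallestEigenvalue hn hM * (v ⬝ᵥ v) ≤ v ⬝ᵥ M *ᵥ v := by
  obtain ⟨i₀, hi₀⟩ := hM.exists_forall_ne_secondSmallestEigenvalue_le hn
  have h0 := hM.coord_eq_zero_of_kernel (fun i hi => hpos.trans_le (hi₀ i hi)) hu hMu huv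
  rw [← hM.sum_coord_mul_coord v (M *ᵥ v), ← hM.sum_coord_mul_coord v v, Finset.mul_sum]
  refine Finset.sum_le_sum fun i _ => ?_
  rw [hM.coord_mulVec]
  rcases eq_or_ne i i₀ with rfl | hi
  · simp [h0]
  · nlinarith [hi₀ i hi, mul_self_nonneg (hM.eigenvectorBasis i ⬝ᵥ v)]

/-- Squaring eigenvalue bounds requires nonnegative eigenvalues. The only one that might be negative
has index `i₀`, along which `v` has no component. -/
theorem IsHermitian.dotProduct_self_mulVec_le :
    (M *ᵥ v) ⬝ᵥ (M *ᵥ v) ≤ largestEigenvalue hM ^ 2 * (v ⬝ᵥ v) := by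
  obtain ⟨i₀, hi₀⟩ := hM.exists_forall_ne_secondSmallestEigenvalue_le hn
  have h0 := hM.coord_eq_zero_of_kernel (fun i hi => hpos.trans_le (hi₀ i hi)) hu hMu huv
  rw [← hM.sum_coord_mul_coord (M *ᵥ v) (M *ᵥ v), ← hM.sum_coord_mul_coord v v, Finset.mul_sum]
  refine Finset.sum_le_sum fun i _ => ?_
  rw [hM.coord_mulVec]
  rcases eq_or_ne i i₀ with rfl | hi
  · simp [h0]
  · have h1 := pow_le_pow_left₀ (hpos.trans_le (hi₀ i hi)).le
      (hM.eigenvalues_le_largestEigenvalue i) 2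
    nlinarith [mul_self_nonneg (hM.eigenvectorBasis i ⬝ᵥ v)]

end Eigenvalues

end Matrix

/-! ### Laplacian estimates for the network coupling. -/

namespace WeightedGraph

open Matrix

variable {N : ℕ} (G : WeightedGraph N)

theorem laplacian_mulVec (y : Fin N → ℝ) (i : Fin N) :
    (G.laplacian *ᵥ y) i = -∑ j, G.weight i j * (y j - y i) := by
  rw [laplacian, sub_mulVec, Pi.sub_apply, mulVec_diagonal]
  simp only [mulVec, dotProduct, mul_sub, Finset.sum_sub_distrib, Finset.sum_mul]
  ring

/-- Exchanging `i` and `j` gives a second expression of the form, and the two add up to the squares.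
The factor `2` reflects that the double sum meets each edge twice. -/
theorem dotProduct_laplacian (y : Fin N → ℝ) :
    ∑ i, ∑ j, G.weight i j * (y j - y i) ^ 2 = 2 * (y ⬝ᵥ G.laplacian *ᵥ y) := by
  have h1 : y ⬝ᵥ G.laplacian *ᵥ y = ∑ i, ∑ j, G.weight i j * (y i * (y i - y j)) := by
    simp only [dotProduct, laplacian_mulVec, Finset.mul_sum, ← Finset.sum_neg_distrib]
    exact Finset.sum_congr rfl fun i _ => Finset.sum_congr rfl fun j _ => by ring
  have h2 : y ⬝ᵥ G.laplacian *ᵥ y = ∑ i, ∑ j, G.weight i j * (y j * (y j - y i)) := by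
    rw [h1, Finset.sum_comm]
    exact Finset.sum_congr rfl fun i _ => Finset.sum_congr rfl fun j _ => by
      rw [G.weight_symm i j]
  rw [two_mul]
  nth_rewrite 1 [h1]
  rw [h2, ← Finset.sum_add_distrib]
  refine Finset.sum_congr rfl fun i _ => ?_
  rw [← Finset.sum_add_distrib]
  exact Finset.sum_congr rfl fun j _ => by ring

/-- The diffusive coupling `∑ j, w i j • (z j - z i)` at node `i`. -/
def coupling {m : ℕ} (z : Fin N → Fin m → ℝ) (i : Fin N) : Fin m → ℝ :=
  ∑ j, G.weight i j • (z j - z i)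

theorem coupling_apply {m : ℕ} (z : Fin N → Fin m → ℝ) (i : Fin N) (k : Fin m) :
    G.coupling z i k = -(G.laplacian *ᵥ fun j => z j k) i := by
  simp [coupling, laplacian_mulVec, Finset.sum_apply]

theorem mulVec_coupling {m q : ℕ} (C : Matrix (Fin q) (Fin m) ℝ) (z : Fin N → Fin m → ℝ)
    (i : Fin N) : C *ᵥ G.coupling z i = G.coupling (fun j => C *ᵥ z j) i := by
  simp only [coupling, mulVec_sum, mulVec_smul, mulVec_sub]

theorem sum_coupling {m : ℕ} (z : Fin N → Fin m → ℝ) : ∑ i, G.coupling z i = 0 := by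
  have h : ∑ i, G.coupling z i = -∑ i, G.coupling z i := by
    conv_lhs => simp only [coupling]
    rw [Finset.sum_comm]
    simp only [coupling, ← Finset.sum_neg_distrib]
    refine Finset.sum_congr rfl fun i _ => Finset.sum_congr rfl fun j _ => ?_
    rw [G.weight_symm i j, ← smul_neg, neg_sub]
  exact self_eq_neg.1 h

section Bounds

variable {G} {m : ℕ} {lo hi : ℝ}

/-- Bounds of the Laplacian on the orthogonal complement of the consensus space. -/
structure LaplacianBounds (G : WeightedGraph N) (lo hi : ℝ) : Prop where
  lower : ∀ y : Fin N → ℝ, ∑ i, y i = 0 → lo * (y ⬝ᵥ y) ≤ y ⬝ᵥ G.laplacian *ᵥ y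
  upper : ∀ y : Fin N → ℝ, ∑ i, y i = 0 → y ⬝ᵥ G.laplacian *ᵥ y ≤ hi * (y ⬝ᵥ y)
  norm_upper : ∀ y : Fin N → ℝ, ∑ i, y i = 0 →
    (G.laplacian *ᵥ y) ⬝ᵥ (G.laplacian *ᵥ y) ≤ hi ^ 2 * (y ⬝ᵥ y)

theorem laplacianBounds (hN : 2 ≤ N)
    (h : 0 < secondSmallestEigenvalue hN G.laplacian_isHermitian) :
    LaplacianBounds G (secondSmallestEigenvalue hN G.laplacian_isHermitian)
      (largestEigenvalue G.laplacian_isHermitian) := by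
  have hu : (fun _ : Fin N => (1 : ℝ)) ≠ 0 := fun h0 => by
    simpa using congrFun h0 ⟨0, by omega⟩
  have hMu : G.laplacian *ᵥ (fun _ : Fin N => (1 : ℝ)) = 0 := by
    ext i
    simp [laplacian_mulVec]
  have huv {y : Fin N → ℝ} (hy : ∑ i, y i = 0) : (fun _ : Fin N => (1 : ℝ)) ⬝ᵥ y = 0 := by
    simpa [dotProduct] using hy
  exact ⟨fun y hy => IsHermitian.secondSmallestEigenvalue_mul_le hN _ h hu hMu (huv hy),
    fun y _ => IsHermitian.dotProduct_mulVec_le _ y,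
    fun y hy => IsHermitian.dotProduct_self_mulVec_le hN _ h hu hMu (huv hy)⟩

theorem LaplacianBounds.mono {lo' hi' : ℝ} (h : LaplacianBounds G lo hi) (hlo : lo' ≤ lo)
    (hhi : hi ≤ hi') (h0 : 0 ≤ hi) : LaplacianBounds G lo' hi' := by
  have hsq (y : Fin N → ℝ) : 0 ≤ y ⬝ᵥ y := by
    simpa using (PosSemidef.one (n := Fin N) (R := ℝ)).dotProduct_nonneg y
  exact ⟨fun y hy => (mul_le_mul_of_nonneg_right hlo (hsq y)).trans (h.lower y hy),
    fun y hy => (h.upper y hy).trans (mul_le_mul_of_nonneg_right hhi (hsq y)),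
    fun y hy => (h.norm_upper y hy).trans
      (mul_le_mul_of_nonneg_right (pow_le_pow_left₀ h0 hhi 2) (hsq y))⟩

theorem sum_dotProduct_comm (a b : Fin N → Fin m → ℝ) :
    ∑ i, a i ⬝ᵥ b i = ∑ k, (fun i => a i k) ⬝ᵥ fun i => b i k := by
  simp only [dotProduct]
  exact Finset.sum_comm

variable {z : Fin N → Fin m → ℝ}

theorem sum_apply_eq_zero (hz : ∑ i, z i = 0) (k : Fin m) : ∑ i, z i k = 0 := by
  simpa using congrFun hz k

theorem sum_mulVec_eq_zero {q : ℕ} (C : Matrix (Fin q) (Fin m) ℝ) (hz : ∑ i, z i = 0) :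
    ∑ i, C *ᵥ z i = 0 := by
  rw [← mulVec_sum, hz, mulVec_zero]

/-- A factor `C` turns an `R`-weighted sum into a plain one for `C *ᵥ z i`. As `C` acts on each node
separately it commutes with the coupling, so scalar Laplacian bounds apply coordinate by coordinate.
-/
theorem _root_.Matrix.PosSemidef.exists_dotProduct_eq {R : Matrix (Fin m) (Fin m) ℝ}
    (hR : R.PosSemidef) :
    ∃ C : Matrix (Fin m) (Fin m) ℝ, ∀ v, v ⬝ᵥ R *ᵥ v = (C *ᵥ v) ⬝ᵥ (C *ᵥ v) := by
  open scoped MatrixOrder in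
  obtain ⟨C, hC⟩ := CStarAlgebra.nonneg_iff_eq_star_mul_self.1 hR.nonneg
  refine ⟨C, fun v => ?_⟩
  have hC' : R = Cᵀ * C := hC
  rw [hC', ← mulVec_mulVec, dotProduct_mulVec_transpose, transpose_transpose]

theorem LaplacianBounds.sum_dotProduct_coupling_le (h : LaplacianBounds G lo hi)
    (hz : ∑ i, z i = 0) : ∑ i, z i ⬝ᵥ G.coupling z i ≤ -(lo * ∑ i, z i ⬝ᵥ z i) := by
  rw [sum_dotProduct_comm z (G.coupling z), sum_dotProduct_comm z z, Finset.mul_sum, ← Finset.sum_neg_distrib]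
  refine Finset.sum_le_sum fun k _ => ?_
  have e : (fun i => G.coupling z i k) = -(G.laplacian *ᵥ fun j => z j k) :=
    funext fun i => G.coupling_apply z i k
  rw [e, dotProduct_neg]
  exact neg_le_neg (h.lower _ (sum_apply_eq_zero hz k))

theorem LaplacianBounds.sum_coupling_quadratic_le (h : LaplacianBounds G lo hi)
    (hz : ∑ i, z i = 0) {R : Matrix (Fin m) (Fin m) ℝ} (hR : R.PosSemidef) :
    ∑ i, G.coupling z i ⬝ᵥ R *ᵥ G.coupling z i ≤ hi ^ 2 * ∑ i, z i ⬝ᵥ R *ᵥ z i := by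
  obtain ⟨C, hC⟩ := hR.exists_dotProduct_eq
  simp only [hC]
  simp only [mulVec_coupling]
  rw [sum_dotProduct_comm (G.coupling _) (G.coupling _), sum_dotProduct_comm fun i => C *ᵥ z i,
    Finset.mul_sum]
  refine Finset.sum_le_sum fun k _ => ?_
  have e : (fun i => G.coupling (fun j => C *ᵥ z j) i k) =
      -(G.laplacian *ᵥ fun j => (C *ᵥ z j) k) :=
    funext fun i => G.coupling_apply _ i k
  rw [e, neg_dotProduct_neg]
  exact h.norm_upper _ (sum_apply_eq_zero (sum_mulVec_eq_zero C hz) k)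

theorem LaplacianBounds.sum_weight_quadratic_le (h : LaplacianBounds G lo hi)
    (hz : ∑ i, z i = 0) {Q : Matrix (Fin m) (Fin m) ℝ} (hQ : Q.PosSemidef) :
    ∑ i, ∑ j, G.weight i j * ((z j - z i) ⬝ᵥ Q *ᵥ (z j - z i)) ≤
      2 * hi * ∑ i, z i ⬝ᵥ Q *ᵥ z i := by
  obtain ⟨C, hC⟩ := hQ.exists_dotProduct_eq
  simp only [hC]
  simp only [mulVec_sub]
  have e : ∑ i, ∑ j, G.weight i j * ((C *ᵥ z j - C *ᵥ z i) ⬝ᵥ (C *ᵥ z j - C *ᵥ z i)) =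
      ∑ k, ∑ i, ∑ j, G.weight i j * ((C *ᵥ z j) k - (C *ᵥ z i) k) ^ 2 := by
    rw [Finset.sum_comm (s := Finset.univ (α := Fin m))]
    refine Finset.sum_congr rfl fun i _ => ?_
    rw [Finset.sum_comm (s := Finset.univ (α := Fin m))]
    refine Finset.sum_congr rfl fun j _ => ?_
    simp only [dotProduct, Finset.mul_sum, Pi.sub_apply, sq]
  rw [e, sum_dotProduct_comm, Finset.mul_sum]
  refine Finset.sum_le_sum fun k _ => ?_
  rw [G.dotProduct_laplacian fun i => (C *ᵥ z i) k]
  have := h.upper _ (sum_apply_eq_zero (sum_mulVec_eq_zero C hz) k)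
  linarith

end Bounds

end WeightedGraph

open Matrix

/-! ### Disagreement, running cost and dissipation. -/

section Disagreement

variable {N d p : ℕ}

/-- The average of the agent states. -/
def meanState (x : Fin N → Fin d → ℝ) : Fin d → ℝ :=
  (N : ℝ)⁻¹ • ∑ j, x j

/-- The deviation of the agent states from their average. -/
def deviation (x : Fin N → Fin d → ℝ) (i : Fin N) : Fin d → ℝ :=
  x i - meanState x

/-- The quadratic form of `P` summed over the deviations from the average. -/
def disagreement (P : Matrix (Fin d) (Fin d) ℝ) (x : Fin N → Fin d → ℝ) : ℝ :=
  ∑ i, deviation x i ⬝ᵥ P *ᵥ deviation x i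

theorem natCast_smul_meanState (hN : N ≠ 0) (x : Fin N → Fin d → ℝ) :
    (N : ℝ) • meanState x = ∑ j, x j := by
  rw [meanState, smul_inv_smul₀ (Nat.cast_ne_zero.2 hN)]

theorem sum_deviation (hN : N ≠ 0) (x : Fin N → Fin d → ℝ) : ∑ i, deviation x i = 0 := by
  simp only [deviation, Finset.sum_sub_distrib, Finset.sum_const, Finset.card_univ,
    Fintype.card_fin]
  rw [← natCast_smul_meanState hN x, Nat.cast_smul_eq_nsmul, sub_self]

theorem deviation_eq_self {z : Fin N → Fin d → ℝ} (hz : ∑ i, z i = 0) : deviation z = z := by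
  ext1 i
  rw [deviation, meanState, hz, smul_zero, sub_zero]

theorem agentControl_eq (K : Matrix (Fin p) (Fin d) ℝ) (G : WeightedGraph N)
    (x : Fin N → Fin d → ℝ) (i : Fin N) : agentControl K G x i = K *ᵥ G.coupling x i :=
  rfl

theorem agentControl_deviation (K : Matrix (Fin p) (Fin d) ℝ) (G : WeightedGraph N)
    (x : Fin N → Fin d → ℝ) : agentControl K G (deviation x) = agentControl K G x := by
  ext1 i
  simp only [agentControl, deviation, sub_sub_sub_cancel_right]

theorem runningCost_deviation (Q : Matrix (Fin d) (Fin d) ℝ) (R : Matrix (Fin p) (Fin p) ℝ)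
    (K : Matrix (Fin p) (Fin d) ℝ) (G : WeightedGraph N) (x : Fin N → Fin d → ℝ) :
    runningCost Q R K G (deviation x) = runningCost Q R K G x := by
  simp only [runningCost, agentControl_deviation, deviation, sub_sub_sub_cancel_right]

theorem runningCost_nonneg {Q : Matrix (Fin d) (Fin d) ℝ} {R : Matrix (Fin p) (Fin p) ℝ}
    (hQ : Q.PosSemidef) (hR : R.PosSemidef) (K : Matrix (Fin p) (Fin d) ℝ) (G : WeightedGraph N)
    (x : Fin N → Fin d → ℝ) : 0 ≤ runningCost Q R K G x :=
  add_nonneg (Finset.sum_nonneg fun _ _ => hR.dotProduct_nonneg _)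
    (Finset.sum_nonneg fun i _ => Finset.sum_nonneg fun j _ =>
      mul_nonneg (G.weight_nonneg i j) (hQ.dotProduct_nonneg _))

theorem continuous_runningCost (Q : Matrix (Fin d) (Fin d) ℝ) (R : Matrix (Fin p) (Fin p) ℝ)
    (K : Matrix (Fin p) (Fin d) ℝ) (G : WeightedGraph N) :
    Continuous fun x : Fin N → Fin d → ℝ => runningCost Q R K G x := by
  unfold runningCost agentControl
  fun_prop

theorem continuous_meanState : Continuous (meanState : (Fin N → Fin d → ℝ) → Fin d → ℝ) := by
  unfold meanState
  fun_prop

theorem continuous_disagreement (P : Matrix (Fin d) (Fin d) ℝ) :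
    Continuous fun x : Fin N → Fin d → ℝ => disagreement P x := by
  unfold disagreement deviation meanState
  fun_prop

theorem stacked_kronecker (M : Matrix (Fin N) (Fin N) ℝ) (P : Matrix (Fin d) (Fin d) ℝ)
    (x : Fin N → Fin d → ℝ) :
    (fun q : Fin N × Fin d => x q.1 q.2) ⬝ᵥ ((M ⊗ₖ P) *ᵥ fun q : Fin N × Fin d => x q.1 q.2) =
      ∑ i, ∑ j, M i j * (x i ⬝ᵥ P *ᵥ x j) := by
  simp only [dotProduct, mulVec, Fintype.sum_prod_type, kroneckerMap_apply, Finset.mul_sum]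
  refine Finset.sum_congr rfl fun i _ => ?_
  rw [Finset.sum_comm]
  refine Finset.sum_congr rfl fun j _ => Finset.sum_congr rfl fun a _ =>
    Finset.sum_congr rfl fun b _ => ?_
  ring

/-- `I - N⁻¹ 1 1ᵀ` is the orthogonal projection that subtracts the average. -/
theorem costBound_eq_disagreement (hN : N ≠ 0) (P : Matrix (Fin d) (Fin d) ℝ)
    (x : Fin N → Fin d → ℝ) : costBound P x = disagreement P x := by
  have hN' : (N : ℝ) ≠ 0 := Nat.cast_ne_zero.2 hN
  have hsum := (natCast_smul_meanState hN x).symm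
  have h1 : ∑ i, ∑ j, x i ⬝ᵥ P *ᵥ x j = N * (N * (meanState x ⬝ᵥ P *ᵥ meanState x)) := by
    simp only [← dotProduct_sum, ← mulVec_sum, ← sum_dotProduct]
    simp only [hsum, mulVec_smul, dotProduct_smul, smul_dotProduct, smul_eq_mul]
  have h2 : ∑ i, x i ⬝ᵥ P *ᵥ meanState x = N * (meanState x ⬝ᵥ P *ᵥ meanState x) := by
    rw [← sum_dotProduct, hsum, smul_dotProduct, smul_eq_mul]
  have h3 : ∑ i, meanState x ⬝ᵥ P *ᵥ x i = N * (meanState x ⬝ᵥ P *ᵥ meanState x) := by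
    rw [← dotProduct_sum, ← mulVec_sum, hsum, mulVec_smul, dotProduct_smul, smul_eq_mul]
  rw [costBound, stacked_kronecker]
  simp only [Matrix.sub_apply, Matrix.smul_apply, one_apply, of_apply, sub_mul, one_mul, smul_eq_mul, mul_ite,
    mul_one, mul_zero, ite_mul, zero_mul, Finset.sum_sub_distrib, Finset.sum_ite_eq,
    Finset.mem_univ, if_true, h1, ← Finset.mul_sum]
  simp only [disagreement, deviation, mulVec_sub, dotProduct_sub, sub_dotProduct,
    Finset.sum_sub_distrib, h2, h3, Finset.sum_const, Finset.card_univ, Fintype.card_fin,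
    nsmul_eq_mul]
  field_simp
  ring

theorem disagreement_nonneg {P : Matrix (Fin d) (Fin d) ℝ} (hP : P.PosSemidef)
    (x : Fin N → Fin d → ℝ) : 0 ≤ disagreement P x :=
  Finset.sum_nonneg fun _ _ => hP.dotProduct_nonneg _

theorem disagreement_pos {P : Matrix (Fin d) (Fin d) ℝ} (hP : P.PosDef) {x : Fin N → Fin d → ℝ}
    (hx : ∃ i j, x i ≠ x j) : 0 < disagreement P x := by
  obtain ⟨i, hi⟩ : ∃ i, deviation x i ≠ 0 := by
    by_contra! h
    obtain ⟨i, j, hij⟩ := hx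
    exact hij ((sub_eq_zero.1 (h i)).trans (sub_eq_zero.1 (h j)).symm)
  exact Finset.sum_pos' (fun _ _ => hP.posSemidef.dotProduct_nonneg _)
    ⟨i, Finset.mem_univ _, hP.dotProduct_pos hi⟩

/-- The dissipation inequality of the closed-loop network. -/
theorem dissipation {A : Matrix (Fin d) (Fin d) ℝ} {B : Matrix (Fin d) (Fin p) ℝ}
    {Q : Matrix (Fin d) (Fin d) ℝ} {R : Matrix (Fin p) (Fin p) ℝ} {m l : ℝ}
    {P : Matrix (Fin d) (Fin d) ℝ} (hP : IsRiccatiSolution A B Q R m l P)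
    (hQ : Q.PosSemidef) (hR : R.PosSemidef) {G : WeightedGraph N}
    (hG : G.LaplacianBounds m l) {z : Fin N → Fin d → ℝ} (hz : ∑ i, z i = 0) :
    ∑ i, 2 * (z i ⬝ᵥ P *ᵥ (A *ᵥ z i + B *ᵥ agentControl (Bᵀ * P) G z i)) +
      runningCost Q R (Bᵀ * P) G z ≤ -(l * disagreement Q z) := by
  have hPt := hP.1.transpose_eq
  have hdev : deviation z = z := deviation_eq_self hz
  set v : Fin N → Fin p → ℝ := fun i => (Bᵀ * P) *ᵥ z i with hv
  have hv0 : ∑ i, v i = 0 := WeightedGraph.sum_mulVec_eq_zero _ hz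
  have hu (i : Fin N) : agentControl (Bᵀ * P) G z i = G.coupling v i := G.mulVec_coupling _ z i
  have hPB (i : Fin N) (w : Fin p → ℝ) : z i ⬝ᵥ P *ᵥ (B *ᵥ w) = v i ⬝ᵥ w := by
    rw [mulVec_mulVec, dotProduct_mulVec_transpose, transpose_mul, hPt]
  have hric (i : Fin N) : 2 * (z i ⬝ᵥ P *ᵥ (A *ᵥ z i)) + l ^ 2 * (v i ⬝ᵥ R *ᵥ v i) -
      2 * m * (v i ⬝ᵥ v i) + 3 * l * (z i ⬝ᵥ Q *ᵥ z i) = 0 := by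
    have h := congrArg (fun M => z i ⬝ᵥ M *ᵥ z i) hP.2
    simp only [zero_mulVec, dotProduct_zero] at h
    rw [add_mulVec, add_mulVec, dotProduct_add, dotProduct_add, dotProduct_lyapunov _ hPt,
      ← mulVec_mulVec, ← mulVec_mulVec, sub_mulVec, smul_mulVec, smul_mulVec, mulVec_sub,
      mulVec_smul, mulVec_smul, dotProduct_sub, dotProduct_smul, dotProduct_smul,
      smul_mulVec, dotProduct_smul, Matrix.mul_assoc, ← mulVec_mulVec, ← mulVec_mulVec,
      ← mulVec_mulVec, hPB, hPB, mulVec_mulVec (z i) Bᵀ P] at h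
    simp only [smul_eq_mul] at h
    linarith
  have hsum := Finset.sum_eq_zero fun i (_ : i ∈ Finset.univ) => hric i
  simp only [Finset.sum_add_distrib, Finset.sum_sub_distrib, ← Finset.mul_sum] at hsum
  -- These three bounds cancel the `R` and `v ⬝ᵥ v` terms of the Riccati identity and two of its
  -- three multiples of `l Q`; the third remains and yields decay.
  have h1 := hG.sum_dotProduct_coupling_le hv0
  have h2 := hG.sum_coupling_quadratic_le hv0 hR
  have h3 := hG.sum_weight_quadratic_le hz hQ
  simp only [runningCost, disagreement, hdev, hu, mulVec_add, dotProduct_add, hPB,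
    Finset.sum_add_distrib, ← Finset.mul_sum]
  linarith

end Disagreement

/-! ### Differential inequalities across switching times. -/

namespace SwitchingSignal

variable {ι : Type*} (σ : SwitchingSignal ι)

theorem times_lt_succ (k : ℕ) : σ.times k < σ.times (k + 1) := by
  linarith [σ.dwell_le k, σ.dwell_pos]

theorem strictMono_times : StrictMono σ.times :=
  strictMono_nat_of_lt_succ σ.times_lt_succ

theorem times_nonneg (k : ℕ) : 0 ≤ σ.times k := by
  rw [← σ.times_zero]
  exact σ.strictMono_times.monotone k.zero_le

theorem natCast_mul_dwell_le (k : ℕ) : k * σ.dwell ≤ σ.times k := by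
  induction k with
  | zero => simp [σ.times_zero]
  | succ k ih =>
    push_cast
    linarith [σ.dwell_le k]

theorem tendsto_times : Filter.Tendsto σ.times Filter.atTop Filter.atTop :=
  Filter.tendsto_atTop_mono σ.natCast_mul_dwell_le
    (tendsto_natCast_atTop_atTop.atTop_mul_const σ.dwell_pos)

theorem notMem_range_times {k : ℕ} {t : ℝ} (ht : t ∈ Set.Ioo (σ.times k) (σ.times (k + 1))) :
    t ∉ Set.range σ.times := by
  rintro ⟨j, rfl⟩
  have h1 := σ.strictMono_times.lt_iff_lt.1 ht.1
  have h2 := σ.strictMono_times.lt_iff_lt.1 ht.2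
  omega

theorem Icc_times_subset (k : ℕ) : Set.Icc (σ.times k) (σ.times (k + 1)) ⊆ Set.Ici 0 :=
  fun _ ht => (σ.times_nonneg k).trans ht.1

/-- A continuous function whose derivative is nonpositive away from the switching times is
antitone. -/
theorem antitoneOn_of_hasDerivAt_nonpos {f f' : ℝ → ℝ} (hf : ContinuousOn f (Set.Ici 0))
    (hf' : ∀ t, 0 < t → t ∉ Set.range σ.times → HasDerivAt f (f' t) t)
    (hle : ∀ t, 0 < t → t ∉ Set.range σ.times → f' t ≤ 0) : AntitoneOn f (Set.Ici 0) := by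
  have hpiece (k : ℕ) : AntitoneOn f (Set.Icc (σ.times k) (σ.times (k + 1))) := by
    have hd {t : ℝ} (ht : t ∈ interior (Set.Icc (σ.times k) (σ.times (k + 1)))) :
        0 < t ∧ t ∉ Set.range σ.times := by
      rw [interior_Icc] at ht
      exact ⟨(σ.times_nonneg k).trans_lt ht.1, σ.notMem_range_times ht⟩
    refine antitoneOn_of_deriv_nonpos (convex_Icc _ _) (hf.mono (σ.Icc_times_subset k))
      (fun t ht => (hf' t (hd ht).1 (hd ht).2).differentiableAt.differentiableWithinAt)
      fun t ht => ?_
    rw [(hf' t (hd ht).1 (hd ht).2).deriv]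
    exact hle t (hd ht).1 (hd ht).2
  have hinit (k : ℕ) : AntitoneOn f (Set.Icc 0 (σ.times k)) := by
    induction k with
    | zero => simp [σ.times_zero]
    | succ k ih =>
      have h := ih.union_right (hpiece k) (isGreatest_Icc (σ.times_nonneg k))
        (isLeast_Icc (σ.times_lt_succ k).le)
      rwa [Set.Icc_union_Icc_eq_Icc (σ.times_nonneg k) (σ.times_lt_succ k).le] at h
  intro a ha b hb hab
  obtain ⟨k, hk⟩ := (σ.tendsto_times.eventually_ge_atTop b).exists
  exact hinit k ⟨ha, hab.trans hk⟩ ⟨hb, hk⟩ hab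

/-- Gronwall's inequality with exceptional switching times. -/
theorem le_mul_exp_of_hasDerivAt_le {f f' : ℝ → ℝ} {c : ℝ} (hf : ContinuousOn f (Set.Ici 0))
    (hf' : ∀ t, 0 < t → t ∉ Set.range σ.times → HasDerivAt f (f' t) t)
    (hle : ∀ t, 0 < t → t ∉ Set.range σ.times → f' t ≤ c * f t) {t : ℝ} (ht : 0 ≤ t) :
    f t ≤ f 0 * Real.exp (c * t) := by
  have hexp (t : ℝ) : HasDerivAt (fun s => Real.exp (-(c * s))) (Real.exp (-(c * t)) * -c) t := by
    simpa using ((hasDerivAt_id t).const_mul c).neg.exp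
  have h := σ.antitoneOn_of_hasDerivAt_nonpos (f := fun t => f t * Real.exp (-(c * t)))
    (hf.mul (by fun_prop)) (fun t ht hts => (hf' t ht hts).mul (hexp t))
    (fun t ht hts => by
      have := mul_le_mul_of_nonneg_right (hle t ht hts) (Real.exp_pos (-(c * t))).le
      linarith) Set.self_mem_Ici ht ht
  simp only [mul_zero, neg_zero, Real.exp_zero, mul_one, Real.exp_neg] at h
  rwa [← div_eq_mul_inv, div_le_iff₀ (Real.exp_pos _)] at h

/-- Integrating a dissipation inequality `V' + φ ≤ 0` for a storage function `V ≥ 0`. -/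
theorem integral_Ioi_le_of_dissipation {V V' φ : ℝ → ℝ} (hV : ContinuousOn V (Set.Ici 0))
    (hV' : ∀ t, 0 < t → t ∉ Set.range σ.times → HasDerivAt V (V' t) t)
    (hle : ∀ t, 0 < t → t ∉ Set.range σ.times → V' t + φ t ≤ 0)
    (hV0 : ∀ t, 0 ≤ V t) (hφ0 : ∀ t, 0 ≤ φ t)
    (hφ : ∀ k, MeasureTheory.IntegrableOn φ (Set.Icc (σ.times k) (σ.times (k + 1)))) :
    MeasureTheory.IntegrableOn φ (Set.Ioi 0) ∧ ∫ t in Set.Ioi (0 : ℝ), φ t ≤ V 0 := by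
  have hint (k : ℕ) : IntervalIntegrable φ MeasureTheory.volume (σ.times k) (σ.times (k + 1)) :=
    (intervalIntegrable_iff_integrableOn_Icc_of_le (σ.times_lt_succ k).le).2 (hφ k)
  have hpiece (k : ℕ) :
      ∫ t in (σ.times k)..(σ.times (k + 1)), φ t ≤ V (σ.times k) - V (σ.times (k + 1)) := by
    have h := intervalIntegral.integral_le_sub_of_hasDeriv_right_of_le (g := fun t => -V t)
      (g' := fun t => -V' t) (σ.times_lt_succ k).le (hV.mono (σ.Icc_times_subset k)).neg
      (fun t ht => (hV' t ((σ.times_nonneg k).trans_lt ht.1)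
        (σ.notMem_range_times ht)).neg.hasDerivWithinAt) (hφ k)
      (fun t ht => by
        linarith [hle t ((σ.times_nonneg k).trans_lt ht.1) (σ.notMem_range_times ht)])
    linarith
  have hinit (k : ℕ) : IntervalIntegrable φ MeasureTheory.volume 0 (σ.times k) ∧
      ∫ t in (0 : ℝ)..(σ.times k), φ t ≤ V 0 - V (σ.times k) := by
    induction k with
    | zero => simp [σ.times_zero]
    | succ k ih =>
      refine ⟨ih.1.trans (hint k), ?_⟩
      rw [← intervalIntegral.integral_add_adjacent_intervals ih.1 (hint k)]
      linarith [ih.2, hpiece k]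
  have hbound (k : ℕ) : ∫ t in (0 : ℝ)..(σ.times k), φ t ≤ V 0 := by
    linarith [(hinit k).2, hV0 (σ.times k)]
  -- The integrand is nonnegative and its integrals up to the unbounded switching times are at most
  -- `V 0`, so the improper integral converges.
  have hI : MeasureTheory.IntegrableOn φ (Set.Ioi 0) := by
    refine MeasureTheory.integrableOn_Ioi_of_intervalIntegral_norm_bounded (V 0) 0
      (fun k => ?_) σ.tendsto_times (Filter.Eventually.of_forall fun k => ?_)
    · exact (intervalIntegrable_iff_integrableOn_Ioc_of_le (σ.times_nonneg k)).1 (hinit k).1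
    · simpa only [Real.norm_of_nonneg (hφ0 _)] using hbound k
  exact ⟨hI, le_of_tendsto' (MeasureTheory.intervalIntegral_tendsto_integral_Ioi 0 hI
    σ.tendsto_times) hbound⟩

end SwitchingSignal

/-! ### Trajectories: average, cost and convergence. -/

theorem HasDerivAt.dotProduct_mulVec_self {d : ℕ} {P : Matrix (Fin d) (Fin d) ℝ} (hP : Pᵀ = P)
    {z : ℝ → Fin d → ℝ} {z' : Fin d → ℝ} {t : ℝ} (hz : HasDerivAt z z' t) :
    HasDerivAt (fun s => z s ⬝ᵥ P *ᵥ z s) (2 * (z t ⬝ᵥ P *ᵥ z')) t := by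
  have hc := hasDerivAt_pi.1 hz
  have h : HasDerivAt (fun s => ∑ a, z s a * ∑ b, P a b * z s b)
      (∑ a, (z' a * ∑ b, P a b * z t b + z t a * ∑ b, P a b * z' b)) t :=
    HasDerivAt.fun_sum fun a _ =>
      (hc a).mul (HasDerivAt.fun_sum fun b _ => (hc b).const_mul (P a b))
  convert! h using 1
  rw [Finset.sum_add_distrib]
  change _ = z' ⬝ᵥ P *ᵥ z t + z t ⬝ᵥ P *ᵥ z'
  rw [dotProduct_mulVec_comm_of_symm hP z' (z t), two_mul]

namespace IsTrajectory

variable {N d p : ℕ} {ι : Type*} {A : Matrix (Fin d) (Fin d) ℝ} {B : Matrix (Fin d) (Fin p) ℝ}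
  {K : Matrix (Fin p) (Fin d) ℝ} {G : ι → WeightedGraph N} {σ : SwitchingSignal ι}
  {x y : ℝ → Fin N → Fin d → ℝ}

theorem hasDerivAt_meanState (hx : IsTrajectory A B (fun _ => 0) K G σ x) {t : ℝ} (ht : 0 < t)
    (hts : t ∉ Set.range σ.times) :
    HasDerivAt (fun s => meanState (x s)) (A *ᵥ meanState (x t)) t := by
  have h := (HasDerivAt.fun_sum fun i (_ : i ∈ Finset.univ) =>
    hx.hasDerivAt t ht hts i).const_smul (N : ℝ)⁻¹
  convert! h using 1
  simp only [add_zero, agentControl_eq, Finset.sum_add_distrib, ← mulVec_sum,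
    WeightedGraph.sum_coupling, mulVec_zero, meanState, mulVec_smul]

theorem hasDerivAt_deviation (hx : IsTrajectory A B (fun _ => 0) K G σ x) {t : ℝ} (ht : 0 < t)
    (hts : t ∉ Set.range σ.times) (i : Fin N) :
    HasDerivAt (fun s => deviation (x s) i) (A *ᵥ deviation (x t) i +
      B *ᵥ agentControl K (G (σ.signal t)) (deviation (x t)) i) t := by
  have h := (hx.hasDerivAt t ht hts i).sub (hx.hasDerivAt_meanState ht hts)
  convert! h using 1
  rw [agentControl_deviation, deviation, mulVec_sub, add_zero]
  abel

theorem hasDerivAt_disagreement (hx : IsTrajectory A B (fun _ => 0) K G σ x) {t : ℝ} (ht : 0 < t)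
    (hts : t ∉ Set.range σ.times) {P : Matrix (Fin d) (Fin d) ℝ} (hP : Pᵀ = P) :
    HasDerivAt (fun s => disagreement P (x s))
      (∑ i, 2 * (deviation (x t) i ⬝ᵥ P *ᵥ (A *ᵥ deviation (x t) i +
        B *ᵥ agentControl K (G (σ.signal t)) (deviation (x t)) i))) t :=
  HasDerivAt.fun_sum fun i _ => (hx.hasDerivAt_deviation ht hts i).dotProduct_mulVec_self hP

theorem continuousOn_disagreement (hx : IsTrajectory A B (fun _ => 0) K G σ x)
    (P : Matrix (Fin d) (Fin d) ℝ) :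
    ContinuousOn (fun s => disagreement P (x s)) (Set.Ici 0) :=
  (continuous_disagreement P).comp_continuousOn hx.continuousOn

theorem integrableOn_runningCost (hx : IsTrajectory A B (fun _ => 0) K G σ x)
    (Q : Matrix (Fin d) (Fin d) ℝ) (R : Matrix (Fin p) (Fin p) ℝ) (k : ℕ) :
    MeasureTheory.IntegrableOn (fun t => runningCost Q R K (G (σ.signal t)) (x t))
      (Set.Icc (σ.times k) (σ.times (k + 1))) := by
  obtain ⟨s, hs⟩ := Set.nonempty_Ioo.2 (σ.times_lt_succ k)
  have hcont : ContinuousOn (fun t => runningCost Q R K (G (σ.signal s)) (x t))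
      (Set.Icc (σ.times k) (σ.times (k + 1))) :=
    (continuous_runningCost Q R K _).comp_continuousOn
      (hx.continuousOn.mono (σ.Icc_times_subset k))
  -- The signal is arbitrary at the switching times; dropping the null endpoints leaves an interval
  -- on which the graph is fixed.
  rw [integrableOn_Icc_iff_integrableOn_Ioo]
  refine (hcont.integrableOn_Icc.mono_set Set.Ioo_subset_Icc_self).congr_fun (fun t ht => ?_)
    measurableSet_Ioo
  simp only [σ.const k t ht s hs]

/-- The average of the agent states does not depend on the trajectory. -/
theorem meanState_eq [Nonempty (Fin d)] (hx : IsTrajectory A B (fun _ => 0) K G σ x)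
    (hy : IsTrajectory A B (fun _ => 0) K G σ y) (h0 : x 0 = y 0) {t : ℝ} (ht : 0 ≤ t) :
    meanState (x t) = meanState (y t) := by
  set e : ℝ → Fin d → ℝ := fun s => meanState (x s) - meanState (y s) with he
  -- Since `Aᵀ + A ≤ c`, the squared distance of the averages grows at rate at most `c`, and it
  -- starts at zero.
  obtain ⟨c, -, hc⟩ := exists_le_smul (PosDef.one (n := Fin d) (R := ℝ)) (Y := Aᵀ * 1 + 1 * A)
    (by simp [add_comm])
  have hcont : ContinuousOn (fun s => e s ⬝ᵥ (1 : Matrix (Fin d) (Fin d) ℝ) *ᵥ e s)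
      (Set.Ici 0) := by
    have hE : ContinuousOn e (Set.Ici 0) :=
      (continuous_meanState.comp_continuousOn hx.continuousOn).sub
        (continuous_meanState.comp_continuousOn hy.continuousOn)
    have hq : Continuous fun v : Fin d → ℝ => v ⬝ᵥ (1 : Matrix (Fin d) (Fin d) ℝ) *ᵥ v := by
      fun_prop
    exact hq.comp_continuousOn hE
  have h := σ.le_mul_exp_of_hasDerivAt_le (c := c) hcont
    (fun s hs hss => ((hx.hasDerivAt_meanState hs hss).sub
      (hy.hasDerivAt_meanState hs hss)).dotProduct_mulVec_self transpose_one)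
    (fun s _ _ => by
      have := hc.dotProduct_nonneg (e s)
      rw [sub_mulVec, dotProduct_sub, dotProduct_lyapunov _ transpose_one, smul_mulVec,
        dotProduct_smul, smul_eq_mul] at this
      simp only [← mulVec_sub]
      exact sub_nonneg.1 this) ht
  have he0 : e 0 = 0 := by simp [he, h0]
  rw [he0, zero_dotProduct, zero_mul, one_mulVec] at h
  have hnn : 0 ≤ e t ⬝ᵥ e t := Finset.sum_nonneg fun _ _ => mul_self_nonneg _
  exact sub_eq_zero.1 (dotProduct_self_eq_zero.1 (le_antisymm h hnn))

section ClosedLoop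

variable {Q : Matrix (Fin d) (Fin d) ℝ} {R : Matrix (Fin p) (Fin p) ℝ} {m l : ℝ}
  {P : Matrix (Fin d) (Fin d) ℝ}

theorem costAtMost (hN : N ≠ 0) (hP : IsRiccatiSolution A B Q R m l P) (hQ : Q.PosSemidef)
    (hR : R.PosSemidef) (hl : 0 ≤ l) (hG : ∀ k, (G k).LaplacianBounds m l)
    (hx : IsTrajectory A B (fun _ => 0) (Bᵀ * P) G σ x) :
    CostAtMost Q R (Bᵀ * P) G σ x (costBound P (x 0)) := by
  rw [costBound_eq_disagreement hN]
  refine σ.integral_Ioi_le_of_dissipation (hx.continuousOn_disagreement P)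
    (fun t ht hts => hx.hasDerivAt_disagreement ht hts hP.1.transpose_eq) (fun t _ _ => ?_)
    (fun t => disagreement_nonneg hP.1.posSemidef _) (fun t => runningCost_nonneg hQ hR _ _ _)
    (hx.integrableOn_runningCost Q R)
  have h := dissipation hP hQ hR (hG (σ.signal t)) (sum_deviation hN (x t))
  rw [runningCost_deviation] at h
  linarith [mul_nonneg hl (disagreement_nonneg hQ (deviation (x t)))]

theorem tendsto_deviation [Nonempty (Fin d)] (hN : N ≠ 0) (hP : IsRiccatiSolution A B Q R m l P)
    (hQ : Q.PosDef) (hR : R.PosSemidef) (hl : 0 < l) (hG : ∀ k, (G k).LaplacianBounds m l)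
    (hx : IsTrajectory A B (fun _ => 0) (Bᵀ * P) G σ x) (i : Fin N) :
    Filter.Tendsto (fun t => deviation (x t) i) Filter.atTop (𝓝 0) := by
  -- `μ P ≤ Q` gives the decay rate `l μ` of the storage function, and `ν ≤ P` converts its decay
  -- into decay of each deviation.
  obtain ⟨μ, hμ, hμQ⟩ := exists_pos_smul_le hP.1 hQ
  obtain ⟨ν, hν, hνP⟩ := exists_pos_smul_le (PosDef.one (n := Fin d) (R := ℝ)) hP.1
  have hdecay {t : ℝ} (ht : 0 ≤ t) :
      disagreement P (x t) ≤ disagreement P (x 0) * Real.exp (-(l * μ) * t) := by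
    refine σ.le_mul_exp_of_hasDerivAt_le (hx.continuousOn_disagreement P)
      (fun t ht hts => hx.hasDerivAt_disagreement ht hts hP.1.transpose_eq) (fun t _ _ => ?_) ht
    have h := dissipation hP hQ.posSemidef hR (hG (σ.signal t)) (sum_deviation hN (x t))
    have h1 := runningCost_nonneg hQ.posSemidef hR (Bᵀ * P) (G (σ.signal t)) (deviation (x t))
    have hdev : deviation (deviation (x t)) = deviation (x t) :=
      deviation_eq_self (sum_deviation hN (x t))
    have h2 : μ * disagreement P (x t) ≤ disagreement Q (deviation (x t)) := by
      rw [disagreement, disagreement, hdev, Finset.mul_sum]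
      exact Finset.sum_le_sum fun j _ => hμQ _
    nlinarith
  have hlim : Filter.Tendsto
      (fun t => Real.sqrt (disagreement P (x 0) * Real.exp (-(l * μ) * t) / ν))
      Filter.atTop (𝓝 0) := by
    have h : Filter.Tendsto (fun t : ℝ => Real.exp (-(l * μ) * t)) Filter.atTop (𝓝 0) :=
      Real.tendsto_exp_atBot.comp
        (Filter.tendsto_id.const_mul_atTop_of_neg (neg_neg_of_pos (mul_pos hl hμ)))
    have h' := ((h.const_mul (disagreement P (x 0))).div_const ν).sqrt
    simpa using h'
  rw [tendsto_pi_nhds]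
  intro a
  refine squeeze_zero_norm' ?_ hlim
  filter_upwards [Filter.eventually_ge_atTop 0] with t ht
  refine Real.abs_le_sqrt ((le_div_iff₀ hν).2 ?_)
  have h1 : deviation (x t) i a ^ 2 ≤ deviation (x t) i ⬝ᵥ deviation (x t) i := by
    rw [sq]
    exact Finset.single_le_sum (f := fun b => deviation (x t) i b * deviation (x t) i b)
      (fun b _ => mul_self_nonneg _) (Finset.mem_univ a)
  have h2 := hνP (deviation (x t) i)
  rw [one_mulVec] at h2
  have h3 : deviation (x t) i ⬝ᵥ P *ᵥ deviation (x t) i ≤ disagreement P (x t) :=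
    Finset.single_le_sum (f := fun j => deviation (x t) j ⬝ᵥ P *ᵥ deviation (x t) j)
      (fun j _ => hP.1.posSemidef.dotProduct_nonneg _) (Finset.mem_univ i)
  nlinarith [hdecay ht]

end ClosedLoop

end IsTrajectory

/-! ### Assembly of the theorem. -/

theorem achievesGuaranteedCostConsensus_of_isRiccatiSolution {N d p : ℕ} [Nonempty (Fin d)]
    (hN : N ≠ 0) {ι : Type*} {A : Matrix (Fin d) (Fin d) ℝ} {B : Matrix (Fin d) (Fin p) ℝ}
    {G : ι → WeightedGraph N} {σ : SwitchingSignal ι} {Q : Matrix (Fin d) (Fin d) ℝ}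
    {R : Matrix (Fin p) (Fin p) ℝ} {m l : ℝ} {P : Matrix (Fin d) (Fin d) ℝ}
    (hP : IsRiccatiSolution A B Q R m l P) (hQ : Q.PosDef) (hR : R.PosSemidef) (hl : 0 < l)
    (hG : ∀ k, (G k).LaplacianBounds m l) :
    AchievesGuaranteedCostConsensus A B (fun _ => 0) Q R (Bᵀ * P) G σ := by
  intro x₀
  have hβ : 0 ≤ costBound P x₀ := by
    rw [costBound_eq_disagreement hN]
    exact disagreement_nonneg hP.1.posSemidef x₀
  -- The consensus function is chosen before the trajectory: it is the average along any one
  -- trajectory from `x₀`, and by `meanState_eq` the choice is immaterial.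
  obtain ⟨c, hc⟩ : ∃ c : ℝ → Fin d → ℝ, ∀ x, IsTrajectory A B (fun _ => 0) (Bᵀ * P) G σ x →
      x 0 = x₀ → ∀ t, 0 ≤ t → meanState (x t) = c t := by
    by_cases h : ∃ y, IsTrajectory A B (fun _ => 0) (Bᵀ * P) G σ y ∧ y 0 = x₀
    · obtain ⟨y, hy, hy0⟩ := h
      exact ⟨fun t => meanState (y t), fun x hx hx0 t ht =>
        hx.meanState_eq hy (hx0.trans hy0.symm) ht⟩
    · exact ⟨0, fun x hx hx0 => (h ⟨x, hx, hx0⟩).elim⟩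
  -- The added `1` keeps the constant positive when all initial states coincide and `costBound`
  -- vanishes.
  refine ⟨costBound P x₀ + 1, by linarith, c, fun x hx hx0 => ⟨fun i => ?_, ?_⟩⟩
  · refine (hx.tendsto_deviation hN hP hQ hR hl hG i).congr' ?_
    filter_upwards [Filter.eventually_ge_atTop 0] with t ht
    rw [deviation, hc x hx hx0 t ht]
  · have h := hx.costAtMost hN hP hQ.posSemidef hR hl.le hG
    rw [hx0] at h
    exact ⟨h.1, h.2.trans (by linarith)⟩

theorem existsUnique_isRiccatiSolution {d p : ℕ} [Nonempty (Fin d)]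
    {A : Matrix (Fin d) (Fin d) ℝ} {B : Matrix (Fin d) (Fin p) ℝ} (hAB : IsStabilizable A B)
    {Q : Matrix (Fin d) (Fin d) ℝ} {R : Matrix (Fin p) (Fin p) ℝ} (hQ : Q.PosDef)
    (hR : R.PosDef) {m l : ℝ} (hl : 0 < l)
    (hlam : l ^ 2 * largestEigenvalue hR.isHermitian < 2 * m) :
    ∃ P, IsRiccatiSolution A B Q R m l P ∧ ∀ P', IsRiccatiSolution A B Q R m l P' → P' = P := by
  set S : Matrix (Fin p) (Fin p) ℝ := (2 * m) • 1 - l ^ 2 • R with hS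
  have hSpos : S.PosDef := by
    refine .of_isSymm (by simp [hS, hR.transpose_eq]) fun v hv => ?_
    have h1 := hR.isHermitian.dotProduct_mulVec_le v
    have h2 : 0 < v ⬝ᵥ v := by simpa using PosDef.one.dotProduct_pos hv
    simp only [hS, sub_mulVec, smul_mulVec, one_mulVec, dotProduct_sub, dotProduct_smul,
      smul_eq_mul]
    nlinarith [mul_le_mul_of_nonneg_left h1 (sq_nonneg l), mul_lt_mul_of_pos_right hlam h2]
  have e (P : Matrix (Fin d) (Fin d) ℝ) :
      Aᵀ * P + P * A + P * (l ^ 2 • (B * R * Bᵀ) - (2 * m) • (B * Bᵀ)) * P + (3 * l) • Q =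
        Aᵀ * P + P * A - P * (B * S * Bᵀ) * P + (3 * l) • Q := by
    have : l ^ 2 • (B * R * Bᵀ) - (2 * m) • (B * Bᵀ) = -(B * S * Bᵀ) := by
      simp only [hS, Matrix.mul_sub, Matrix.sub_mul, Matrix.mul_smul, Matrix.smul_mul,
        Matrix.mul_one, neg_sub]
    rw [this, Matrix.mul_neg, Matrix.neg_mul, ← sub_eq_add_neg]
  obtain ⟨P, ⟨hP, hP0⟩, huniq⟩ :=
    existsUnique_riccati_of_isStabilizable hAB (hQ.smul (by positivity : 0 < 3 * l)) hSpos
  exact ⟨P, ⟨hP, by rw [e, hP0]⟩, fun P' hP' => huniq P' hP'.1 (by rw [← e, hP'.2])⟩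

theorem theorem3 {N d p : ℕ} (hN : 2 ≤ N) (hd : 0 < d) (hp : 0 < p)
    {ι : Type*} [Finite ι] [Nonempty ι]
    (G : ι → WeightedGraph N) (hG : ∀ k, (G k).graph.Connected) (σ : SwitchingSignal ι)
    (A : Matrix (Fin d) (Fin d) ℝ) (B : Matrix (Fin d) (Fin p) ℝ)
    (Q : Matrix (Fin d) (Fin d) ℝ) (R : Matrix (Fin p) (Fin p) ℝ)
    (hQ : Q.PosDef) (hR : R.PosDef)
    (hAB : IsStabilizable A B)
    (hlam : largestEigenvalue hR.isHermitian < 2 * lambdaMin hN G / lambdaMax G ^ 2) :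
    GuaranteedCostConsensualizable A B (fun _ => 0) Q R G σ ∧
    ∃ P : Matrix (Fin d) (Fin d) ℝ,
      IsRiccatiSolution A B Q R (lambdaMin hN G) (lambdaMax G) P ∧
      (∀ P', IsRiccatiSolution A B Q R (lambdaMin hN G) (lambdaMax G) P' → P' = P) ∧
      AchievesGuaranteedCostConsensus A B (fun _ => 0) Q R (Bᵀ * P) G σ ∧
      (∀ x, IsTrajectory A B (fun _ => 0) (Bᵀ * P) G σ x →
        CostAtMost Q R (Bᵀ * P) G σ x (costBound P (x 0))) ∧
      (∀ x₀ : Fin N → Fin d → ℝ, (∃ i j, x₀ i ≠ x₀ j) → 0 < costBound P x₀) := by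
  have : Nonempty (Fin d) := ⟨⟨0, hd⟩⟩
  have hN0 : N ≠ 0 := by omega
  have hRpos : 0 < largestEigenvalue hR.isHermitian :=
    (hR.eigenvalues_pos ⟨0, hp⟩).trans_le (hR.isHermitian.eigenvalues_le_largestEigenvalue _)
  -- Division by zero gives zero, so `λ_max = 0` would force the positive number `λ_{R,max}` below
  -- zero. The same condition then yields `λ_min > 0`.
  have hl2 : 0 < lambdaMax G ^ 2 := by
    refine lt_of_le_of_ne (sq_nonneg _) fun h => ?_
    rw [← h, div_zero] at hlam
    exact hlam.not_gt hRpos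
  rw [lt_div_iff₀ hl2] at hlam
  have hm : 0 < lambdaMin hN G := by
    have := mul_pos hRpos hl2
    linarith
  have hmin (k : ι) :
      lambdaMin hN G ≤ secondSmallestEigenvalue hN (G k).laplacian_isHermitian :=
    ciInf_le (Set.finite_range _).bddBelow k
  have hmax (k : ι) : largestEigenvalue (G k).laplacian_isHermitian ≤ lambdaMax G :=
    le_ciSup (f := fun k => largestEigenvalue (G k).laplacian_isHermitian)
      (Set.finite_range _).bddAbove k
  have hpos (k : ι) : 0 < largestEigenvalue (G k).laplacian_isHermitian :=
    (hm.trans_le (hmin k)).trans_le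
      (IsHermitian.secondSmallestEigenvalue_le_largestEigenvalue hN _)
  have hl : 0 < lambdaMax G := (hpos (Classical.arbitrary ι)).trans_le (hmax _)
  have hbounds (k : ι) : (G k).LaplacianBounds (lambdaMin hN G) (lambdaMax G) :=
    (WeightedGraph.laplacianBounds hN (hm.trans_le (hmin k))).mono (hmin k) (hmax k) (hpos k).le
  obtain ⟨P, hP, huniq⟩ := existsUnique_isRiccatiSolution hAB hQ hR hl (by linarith)
  have hach : AchievesGuaranteedCostConsensus A B (fun _ => 0) Q R (Bᵀ * P) G σ :=
    achievesGuaranteedCostConsensus_of_isRiccatiSolution hN0 hP hQ hR.posSemidef hl hbounds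
  refine ⟨⟨_, hach⟩, P, hP, huniq, hach, fun x hx =>
    hx.costAtMost hN0 hP hQ.posSemidef hR.posSemidef hl.le hbounds, fun x₀ hx₀ => ?_⟩
  rw [costBound_eq_disagreement hN0]
  exact disagreement_pos hP.1 hx₀

end
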